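/- **Traversals.** An $n$-dimensional traversal is a finite sequence $\theta:\{1,\dots,l\}\to[n]\times\{+,-\}$, $l\ge 0$. An operator $\alpha:[m]\to[n]$ acts by replacing every entry $(i,\pm)$ by the entries $(j,\pm)$ with $j\in\alpha^{-1}(i)$, listed in decreasing order of $j$ for the sign $+$ and in increasing order for the sign $-$. This defines a simplicial set $\mathbb T_0$. Let $(\mathbb T_1)_n$ be the set of pairs $(\theta,p)$ of an $n$-dimensional traversal of length $l$ and a position $p\in\{0,\dots,l\}$; $\alpha$ sends $p$ to the number of entries of $\theta\cdot\alpha$ that come from the first $p$ entries of $\theta$. Let $\mathrm{cod}:\mathbb T_1\to\mathbb T_0$ forget the position. With $\mathrm{dom}(\theta,p)$ the part of $\theta$ after $p$, respectively $\mathrm{dom}^*(\theta,p)$ the part of $\theta$ before $p$, this is a simplicial poset (final, respectively initial, segment ordering). The *simplicial Moore path functor* is the polynomial functor $M=P_{\mathrm{cod}}$ on simplicial sets, $(MX)_n=\sum_{\theta\in(\mathbb T_0)_n}\mathrm{Hom}(\mathrm{cod}^{-1}(\theta),X)$, where $\mathrm{cod}^{-1}(\theta)$ is the pullback of $\mathrm{cod}$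 along $\theta:\Delta^n\to\mathbb T_0$. Let $M_+$ and $M_-$ be the functors obtained in the same way from the traversals with only $+$, respectively only $-$, entries. **Structure maps.** For each of $M,M_+,M_-$: $s:M\Rightarrow 1$ and $\Gamma:M\Rightarrow MM$ are the counit and comultiplication of the polynomial comonad of the final segment ordering (so $s$ evaluates at the initial position, and $\Gamma$ sends a path to the path whose value at a position is the remainder of the path after it); $t:M\Rightarrow1$ and $\Gamma^*:M\Rightarrow MM$ are those of the initial segment ordering; $r:1\Rightarrow M$ gives the path with empty traversal; $\mu:M\,{}_t{\times}_s\,M\Rightarrow M$ is concatenation; $\alpha_{X,Y}:X\times MY\to M(X\times Y)$ is the canonical strength, $(x,(\theta,y))\mapsto(\theta,(x,y))$ with $x$ constant along the fibre; for $M$, $\tau:M\Rightarrow M$ reverses the order and the orientation of traversals and sends a position $p$ to $l-p$. Write $\alpha_X:X\times M1\to MX$ for $\alpha_{X,1}$ followed by $M(X\times 1)\cong MX$, $!:X\to1$, and $\nu$ for the comparison isomorphism $MA\times_{MC}MB\cong M(A\times_CB)$. **Definitions.** Let $\mathcal E$ be a category with finite limits and $M$ an endofunctor with natural transformations $s,t,r,\mu,\Gamma,\alpha$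 of the above types. These form a *Moore structure* if $M$ preserves pullbacks and: 1. $r,s,t,\mu$ make every object $X$ the object of objects of an internal category with object of arrows $MX$, where $\mu(a,b)$ is $a$ followed by $b$; 2. $(M,s,\Gamma)$ is a comonad; 3. $\alpha$ is a strength, i.e. it is compatible with the associativity isomorphisms and $Mp_2.\alpha_{X,Y}=p_2$, and $r,s,t,\mu,\Gamma$ are strong; 4. $\Gamma.r=rM.r$, $\ tM.\Gamma=r.t$, $\ Mt.\Gamma=\alpha_X.(t,M!)$; 5. (distributive law) $\Gamma.\mu=\mu.(M\mu.\nu.(\Gamma.p_1,\alpha_{MX}.(p_2,M!.p_1)),\Gamma.p_2)$. With $\Gamma^*:M\Rightarrow MM$ it is a *two-sided Moore structure* if moreover $(M,t,\Gamma^*)$ is a strong comonad; $\Gamma^*.r=rM.r$, $sM.\Gamma^*=r.s$, $Ms.\Gamma^*=\alpha_X.(s,M!)$ and $\Gamma^*.\mu=\mu.(\Gamma^*.p_1,M\mu.\nu.(\alpha_{MX}.(p_1,M!.p_2),\Gamma^*.p_2))$; $\mu$ is left and right cancellative; and the *sandwich equation* $M\mu.\nu.(\Gamma^*,\Gamma)=\alpha_{MX}.(1,M!)$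 holds. With $\tau:M\Rightarrow M$ it is a *symmetric Moore structure* if moreover $\tau.\tau=1$, $\tau.r=r$, $s.\tau=t$, $t.\tau=s$, $\Gamma^*=\tau M.M\tau.\Gamma.\tau$, $\tau.\alpha_X=\alpha_X.(1\times\tau)$ and $\tau.\mu=\mu.(\tau.p_2,\tau.p_1)$. **Theorem.** On the category of simplicial sets, $(M,s,t,r,\mu,\Gamma,\alpha,\Gamma^*,\tau)$ is a symmetric Moore structure, and the structures described above on $M_+$ and $M_-$ are two-sided Moore structures. The three two-sided Moore structures on $M$, $M_+$ and $M_-$ are distinct: no two of these functors are isomorphic by a natural isomorphism that commutes with $s$ and $t$. -/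

import Mathlib

open CategoryTheory Limits MonoidalCategory CartesianMonoidalCategory

universe v u

/-! ## Moore structures on a category with finite limits -/

section Abstract

variable {E : Type u} [Category.{v} E]

/-- The map `Z ⟶ M (A ×_C B)` induced by two maps `Z ⟶ M A`, `Z ⟶ M B` that agree over `M C`,
for a functor `M` that preserves pullbacks. -/
noncomputable def pullbackPair [HasPullbacks E] (M : E ⥤ E)
    [PreservesLimitsOfShape WalkingCospan M] {A B C Z : E} (f : A ⟶ C) (g : B ⟶ C)
    (a : Z ⟶ M.obj A) (b : Z ⟶ M.obj B) (h : a ≫ M.map f = b ≫ M.map g) :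
    Z ⟶ M.obj (pullback f g) :=
  pullback.lift a b h ≫ (PreservesPullback.iso M f g).inv

/-- `(M, ε, δ)` is a comonad. -/
structure IsComonad (M : E ⥤ E) (ε : M ⟶ 𝟭 E) (δ : M ⟶ M ⋙ M) : Prop where
  counit_left : ∀ X : E, δ.app X ≫ ε.app (M.obj X) = 𝟙 (M.obj X)
  counit_right : ∀ X : E, δ.app X ≫ M.map (ε.app X) = 𝟙 (M.obj X)
  coassoc : ∀ X : E, δ.app X ≫ M.map (δ.app X) = δ.app X ≫ δ.app (M.obj X)

variable [CartesianMonoidalCategory E]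

/-- The length `M! : M X ⟶ M 1` of a path. -/
def pathLength (M : E ⥤ E) (X : E) : M.obj X ⟶ M.obj (𝟙_ E) :=
  M.map (toUnit X)

variable [HasPullbacks E]

/-- The data of a Moore structure on an endofunctor `M`: source, target, constant paths, path
contraction, concatenation and strength, all of them natural. -/
structure MooreData (M : E ⥤ E) where
  s : M ⟶ 𝟭 E
  t : M ⟶ 𝟭 E
  r : 𝟭 E ⟶ M
  Γ : M ⟶ M ⋙ M
  μ : ∀ X : E, pullback (t.app X) (s.app X) ⟶ M.obj X
  μ_natural : ∀ {X Y : E} (f : X ⟶ Y),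
    pullback.map (t.app X) (s.app X) (t.app Y) (s.app Y) (M.map f) (M.map f) f
      (t.naturality f).symm (s.naturality f).symm ≫ μ Y = μ X ≫ M.map f
  α : ∀ X Y : E, X ⊗ M.obj Y ⟶ M.obj (X ⊗ Y)
  α_natural : ∀ {X X' Y Y' : E} (f : X ⟶ X') (g : Y ⟶ Y'),
    (f ⊗ₘ M.map g) ≫ α X' Y' = α X Y ≫ M.map (f ⊗ₘ g)

namespace MooreData

variable {M : E ⥤ E}

/-- The path `μ.(a, b)`: first `a`, then `b`. -/
noncomputable def seq (d : MooreData M) {Z X : E} (a b : Z ⟶ M.obj X)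
    (h : a ≫ d.t.app X = b ≫ d.s.app X) : Z ⟶ M.obj X :=
  pullback.lift a b h ≫ d.μ X

/-- Pointwise concatenation `Mμ.ν.(a, b)` of two paths of paths. -/
noncomputable def pointwiseSeq [PreservesLimitsOfShape WalkingCospan M] (d : MooreData M)
    {Z X : E} (a b : Z ⟶ M.obj (M.obj X))
    (h : a ≫ M.map (d.t.app X) = b ≫ M.map (d.s.app X)) : Z ⟶ M.obj (M.obj X) :=
  pullbackPair M (d.t.app X) (d.s.app X) a b h ≫ M.map (d.μ X)

/-- The map `α_X : X × M 1 ⟶ M X`, sending a point and a length to a constant path. -/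
def constPath (d : MooreData M) (X : E) : X ⊗ M.obj (𝟙_ E) ⟶ M.obj X :=
  d.α X (𝟙_ E) ≫ M.map (fst X (𝟙_ E))

/-- The comultiplication `δ` is compatible with the strength. -/
def IsStrongComult (d : MooreData M) (δ : M ⟶ M ⋙ M) : Prop :=
  ∀ X Y : E, d.α X Y ≫ δ.app (X ⊗ Y) =
    (X ◁ δ.app Y) ≫ d.α X (M.obj Y) ≫ M.map (d.α X Y)

/-- The axioms of a Moore structure. Whenever an equation mentions a map into a pullback, the
existence of that map (that is, the composability of the paths) is part of the axiom. -/
structure IsMoore (d : MooreData M) : Prop where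
  [preserves : PreservesLimitsOfShape WalkingCospan M]
  -- every object is the object of objects of an internal category
  r_s : ∀ X : E, d.r.app X ≫ d.s.app X = 𝟙 X
  r_t : ∀ X : E, d.r.app X ≫ d.t.app X = 𝟙 X
  μ_s : ∀ X : E, d.μ X ≫ d.s.app X = pullback.fst (d.t.app X) (d.s.app X) ≫ d.s.app X
  μ_t : ∀ X : E, d.μ X ≫ d.t.app X = pullback.snd (d.t.app X) (d.s.app X) ≫ d.t.app X
  unit_left : ∀ X : E, ∃ h, d.seq (d.s.app X ≫ d.r.app X) (𝟙 (M.obj X)) h = 𝟙 (M.obj X)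
  unit_right : ∀ X : E, ∃ h, d.seq (𝟙 (M.obj X)) (d.t.app X ≫ d.r.app X) h = 𝟙 (M.obj X)
  assoc : ∀ {Z X : E} (a b c : Z ⟶ M.obj X) (hab : a ≫ d.t.app X = b ≫ d.s.app X)
    (hbc : b ≫ d.t.app X = c ≫ d.s.app X),
    ∃ h h', d.seq (d.seq a b hab) c h = d.seq a (d.seq b c hbc) h'
  -- the comonad
  comonad : IsComonad M d.s d.Γ
  -- the strength
  α_assoc : ∀ X Y Z : E, d.α (X ⊗ Y) Z ≫ M.map (α_ X Y Z).hom =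
    (α_ X Y (M.obj Z)).hom ≫ (X ◁ d.α Y Z) ≫ d.α X (Y ⊗ Z)
  α_snd : ∀ X Y : E, d.α X Y ≫ M.map (snd X Y) = snd X (M.obj Y)
  α_s : ∀ X Y : E, d.α X Y ≫ d.s.app (X ⊗ Y) = X ◁ d.s.app Y
  α_t : ∀ X Y : E, d.α X Y ≫ d.t.app (X ⊗ Y) = X ◁ d.t.app Y
  α_r : ∀ X Y : E, (X ◁ d.r.app Y) ≫ d.α X Y = d.r.app (X ⊗ Y)
  α_μ : ∀ X Y : E, ∃ h, (X ◁ d.μ Y) ≫ d.α X Y =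
    d.seq ((X ◁ pullback.fst (d.t.app Y) (d.s.app Y)) ≫ d.α X Y)
      ((X ◁ pullback.snd (d.t.app Y) (d.s.app Y)) ≫ d.α X Y) h
  α_Γ : d.IsStrongComult d.Γ
  -- interaction of `Γ` with `r` and `t`
  r_Γ : ∀ X : E, d.r.app X ≫ d.Γ.app X = d.r.app X ≫ d.r.app (M.obj X)
  Γ_t : ∀ X : E, d.Γ.app X ≫ d.t.app (M.obj X) = d.t.app X ≫ d.r.app X
  Γ_map_t : ∀ X : E, d.Γ.app X ≫ M.map (d.t.app X) =
    lift (d.t.app X) (pathLength M X) ≫ d.constPath X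
  -- the distributive law `Γ.μ = μ.(Mμ.ν.(Γ.p₁, α.(p₂, M!.p₁)), Γ.p₂)`
  distrib : ∀ X : E,
    let p₁ : pullback (d.t.app X) (d.s.app X) ⟶ M.obj X := pullback.fst _ _
    let p₂ : pullback (d.t.app X) (d.s.app X) ⟶ M.obj X := pullback.snd _ _
    ∃ h h', d.μ X ≫ d.Γ.app X =
      d.seq
        (d.pointwiseSeq (p₁ ≫ d.Γ.app X)
          (lift p₂ (p₁ ≫ pathLength M X) ≫ d.constPath (M.obj X)) h)
        (p₂ ≫ d.Γ.app X) h'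

/-- The axioms of a two-sided Moore structure, with dual path contraction `Γ'`. -/
structure IsTwoSided (d : MooreData M) (Γ' : M ⟶ M ⋙ M) : Prop extends d.IsMoore where
  comonad' : IsComonad M d.t Γ'
  α_Γ' : d.IsStrongComult Γ'
  r_Γ' : ∀ X : E, d.r.app X ≫ Γ'.app X = d.r.app X ≫ d.r.app (M.obj X)
  Γ'_s : ∀ X : E, Γ'.app X ≫ d.s.app (M.obj X) = d.s.app X ≫ d.r.app X
  Γ'_map_s : ∀ X : E, Γ'.app X ≫ M.map (d.s.app X) =
    lift (d.s.app X) (pathLength M X) ≫ d.constPath X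
  -- the distributive law `Γ'.μ = μ.(Γ'.p₁, Mμ.ν.(α.(p₁, M!.p₂), Γ'.p₂))`
  distrib' : ∀ X : E,
    let p₁ : pullback (d.t.app X) (d.s.app X) ⟶ M.obj X := pullback.fst _ _
    let p₂ : pullback (d.t.app X) (d.s.app X) ⟶ M.obj X := pullback.snd _ _
    ∃ h h', d.μ X ≫ Γ'.app X =
      d.seq (p₁ ≫ Γ'.app X)
        (d.pointwiseSeq (lift p₁ (p₂ ≫ pathLength M X) ≫ d.constPath (M.obj X))
          (p₂ ≫ Γ'.app X) h) h'
  -- concatenation is left and right cancellative: on generalized elements this is the universal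
  -- property of the equalizers that express cancellativity
  left_cancel : ∀ {Z X : E} (a b b' : Z ⟶ M.obj X) (h : a ≫ d.t.app X = b ≫ d.s.app X)
    (h' : a ≫ d.t.app X = b' ≫ d.s.app X), d.seq a b h = d.seq a b' h' → b = b'
  right_cancel : ∀ {Z X : E} (a a' b : Z ⟶ M.obj X) (h : a ≫ d.t.app X = b ≫ d.s.app X)
    (h' : a' ≫ d.t.app X = b ≫ d.s.app X), d.seq a b h = d.seq a' b h' → a = a'
  -- the sandwich equation `Mμ.ν.(Γ', Γ) = α.(1, M!)`
  sandwich : ∀ X : E, ∃ h, d.pointwiseSeq (Γ'.app X) (d.Γ.app X) h =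
    lift (𝟙 (M.obj X)) (pathLength M X) ≫ d.constPath (M.obj X)

/-- The axioms of a symmetric Moore structure, with dual path contraction `Γ'` and twist map
`τ`. -/
structure IsSymmetric (d : MooreData M) (Γ' : M ⟶ M ⋙ M) (τ : M ⟶ M) : Prop
    extends d.IsTwoSided Γ' where
  τ_τ : ∀ X : E, τ.app X ≫ τ.app X = 𝟙 (M.obj X)
  r_τ : ∀ X : E, d.r.app X ≫ τ.app X = d.r.app X
  τ_s : ∀ X : E, τ.app X ≫ d.s.app X = d.t.app X
  τ_t : ∀ X : E, τ.app X ≫ d.t.app X = d.s.app X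
  Γ'_eq : ∀ X : E,
    Γ'.app X = τ.app X ≫ d.Γ.app X ≫ M.map (τ.app X) ≫ τ.app (M.obj X)
  α_τ : ∀ X : E, d.constPath X ≫ τ.app X = (X ◁ τ.app (𝟙_ E)) ≫ d.constPath X
  μ_τ : ∀ X : E, ∃ h, d.μ X ≫ τ.app X =
    d.seq (pullback.snd (d.t.app X) (d.s.app X) ≫ τ.app X)
      (pullback.fst (d.t.app X) (d.s.app X) ≫ τ.app X) h

end MooreData

end Abstract

/-! ## Polynomial functors on simplicial sets -/

namespace SimplicialMoore

section Polynomial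

/-- A simplicial set given by its simplices and the action of operators on them. -/
def mkSSet (X : SimplexCategoryᵒᵖ → Type u)
    (act : ∀ {n m : SimplexCategoryᵒᵖ}, (n ⟶ m) → X n → X m)
    (act_id : ∀ (n : SimplexCategoryᵒᵖ) (x : X n), act (𝟙 n) x = x)
    (act_comp : ∀ {n m k : SimplexCategoryᵒᵖ} (φ : n ⟶ m) (ψ : m ⟶ k) (x : X n),
      act (φ ≫ ψ) x = act ψ (act φ x)) : SSet.{u} where
  obj := X
  map φ := ↾(act φ)
  map_id n := ConcreteCategory.hom_ext _ _ (act_id n)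
  map_comp φ ψ := ConcreteCategory.hom_ext _ _ (act_comp φ ψ)

/-- A map of simplicial sets given by its action on simplices. -/
def mkHom {X Y : SSet.{u}} (f : ∀ n : SimplexCategoryᵒᵖ, X.obj n → Y.obj n)
    (nat : ∀ {n m : SimplexCategoryᵒᵖ} (φ : n ⟶ m) (x : X.obj n),
      f m (X.map φ x) = Y.map φ (f n x)) : X ⟶ Y where
  app n := ↾(f n)
  naturality _ _ φ := ConcreteCategory.hom_ext _ _ (nat φ)

theorem ssetHom_ext {X Y : SSet.{u}} {f g : X ⟶ Y}
    (h : ∀ (n : SimplexCategoryᵒᵖ) (x : X.obj n), f.app n x = g.app n x) : f = g :=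
  SSet.hom_ext fun n => ConcreteCategory.hom_ext _ _ (h n)

theorem ssetHom_congr {X Y : SSet.{u}} {f g : X ⟶ Y} (h : f = g) (n : SimplexCategoryᵒᵖ)
    (x : X.obj n) : f.app n x = g.app n x := by
  rw [h]

variable {A B : SSet.{u}}

/-- The fibre `B_a` of `f : B ⟶ A` over an `n`-simplex `a` of `A`, that is, the pullback of `f`
along the map `Δ[n] ⟶ A` that classifies `a`. An `m`-simplex is an operator `[m] ⟶ [n]` together
with an `m`-simplex of `B` over the restriction of `a` along it. -/
def fiber (f : B ⟶ A) {n : SimplexCategoryᵒᵖ} (a : A.obj n) : SSet.{u} :=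
  mkSSet (fun m => {p : (n ⟶ m) × B.obj m // f.app m p.2 = A.map p.1 a})
    (fun φ p => ⟨(p.1.1 ≫ φ, B.map φ p.1.2), by
      rw [NatTrans.naturality_apply, p.2, Functor.map_comp_apply]⟩)
    (fun m p => Subtype.ext (Prod.ext (Category.comp_id _) (by simp)))
    (fun φ ψ p => Subtype.ext (Prod.ext (Category.assoc _ _ _).symm (by simp)))

/-- The map between fibres `B_{a·φ} ⟶ B_a`. -/
def fiberMap (f : B ⟶ A) {n n' : SimplexCategoryᵒᵖ} (φ : n ⟶ n') (a : A.obj n) :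
    fiber f (A.map φ a) ⟶ fiber f a :=
  mkHom (fun _ p => ⟨(φ ≫ p.1.1, p.1.2), by rw [p.2, Functor.map_comp_apply]⟩)
    (fun _ _ => Subtype.ext (Prod.ext (Category.assoc _ _ _).symm rfl))

/-- Two simplices of a polynomial functor are equal if they have the same base and the same
values on the fibre. -/
theorem poly_ext (f : B ⟶ A) {X : SSet.{u}} {n : SimplexCategoryᵒᵖ}
    {p q : Σ a : A.obj n, (fiber f a ⟶ X)} (h : p.1 = q.1)
    (h' : ∀ (m : SimplexCategoryᵒᵖ) (α : n ⟶ m) (b : B.obj m) (hp : f.app m b = A.map α p.1)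
      (hq : f.app m b = A.map α q.1), p.2.app m ⟨(α, b), hp⟩ = q.2.app m ⟨(α, b), hq⟩) :
    p = q := by
  obtain ⟨a, x⟩ := p
  obtain ⟨a', y⟩ := q
  obtain rfl : a = a' := h
  congr 1
  apply ssetHom_ext
  rintro m ⟨⟨α, b⟩, hb⟩
  exact h' m α b hb hb

/-- The value of a map out of a fibre depends only on the underlying simplex. -/
theorem fiber_congr {f : B ⟶ A} {X : SSet.{u}} {n : SimplexCategoryᵒᵖ} {a : A.obj n}
    (x : fiber f a ⟶ X) {m : SimplexCategoryᵒᵖ} {α α' : n ⟶ m} {b b' : B.obj m}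
    (hα : α = α') (hb : b = b') (h : f.app m b = A.map α a) (h' : f.app m b' = A.map α' a) :
    x.app m ⟨(α, b), h⟩ = x.app m ⟨(α', b'), h'⟩ := by
  subst hα hb; rfl

/-- Naturality of a map out of a fibre. -/
theorem fiber_nat {f : B ⟶ A} {X : SSet.{u}} {n : SimplexCategoryᵒᵖ} {a : A.obj n}
    (x : fiber f a ⟶ X) {m k : SimplexCategoryᵒᵖ} (α : n ⟶ m) (b : B.obj m)
    (h : f.app m b = A.map α a) (β : m ⟶ k) (h' : f.app k (B.map β b) = A.map (α ≫ β) a) :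
    X.map β (x.app m ⟨(α, b), h⟩) = x.app k ⟨(α ≫ β, B.map β b), h'⟩ :=
  (NatTrans.naturality_apply x β _).symm

/-- The polynomial functor `P_f` of `f : B ⟶ A`, with
`(P_f X)_n = ∑ (a ∈ A_n), Hom (B_a, X)`. -/
def polyFunctor (f : B ⟶ A) : SSet.{u} ⥤ SSet.{u} where
  obj X := mkSSet (fun n => Σ a : A.obj n, (fiber f a ⟶ X))
    (fun φ p => ⟨A.map φ p.1, fiberMap f φ p.1 ≫ p.2⟩)
    (fun n p => poly_ext f (by simp) fun _ _ _ _ _ =>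
      fiber_congr p.2 (Category.id_comp _) rfl _ _)
    (fun φ ψ p => poly_ext f (by simp) fun _ _ _ _ _ =>
      fiber_congr p.2 (Category.assoc _ _ _) rfl _ _)
  map g := mkHom (fun n p => ⟨p.1, p.2 ≫ g⟩) (fun _ _ => rfl)
  map_id X := ssetHom_ext fun _ _ => rfl
  map_comp g h := ssetHom_ext fun _ _ => rfl

/-- The strength of a polynomial functor: `(x, (a, y)) ↦ (a, (x, y))`, with `x` constant along
the fibre. -/
def polyStrength (f : B ⟶ A) (X Y : SSet.{u}) :
    X ⊗ (polyFunctor f).obj Y ⟶ (polyFunctor f).obj (X ⊗ Y) :=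
  mkHom
    (fun _ p => ⟨p.2.1, mkHom (fun m b => (X.map b.1.1 p.1, p.2.2.app m b))
      (fun φ b => Prod.ext (Functor.map_comp_apply X _ _ _)
        (NatTrans.naturality_apply p.2.2 φ b))⟩)
    (fun _ _ => poly_ext f rfl fun _ _ _ _ _ =>
      Prod.ext (Functor.map_comp_apply X _ _ _).symm rfl)

theorem polyStrength_natural (f : B ⟶ A) {X X' Y Y' : SSet.{u}} (g : X ⟶ X') (h : Y ⟶ Y') :
    (g ⊗ₘ (polyFunctor f).map h) ≫ polyStrength f X' Y' =
      polyStrength f X Y ≫ (polyFunctor f).map (g ⊗ₘ h) :=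
  ssetHom_ext fun n p => poly_ext f rfl fun m α _ _ _ =>
    Prod.ext (show X'.map α (g.app n p.1) = g.app m (X.map α p.1) from
      (NatTrans.naturality_apply g α p.1).symm) rfl

/-- A morphism of polynomials from `f : B ⟶ A` to `g : D ⟶ C`: a map `A ⟶ C` together with a map
`A ×_C D ⟶ B` over `A`. -/
structure PolyHom {A B C D : SSet.{u}} (f : B ⟶ A) (g : D ⟶ C) where
  fwd : A ⟶ C
  bwd : ∀ {n : SimplexCategoryᵒᵖ} (a : A.obj n) (d : D.obj n), g.app n d = fwd.app n a → B.obj n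
  f_bwd : ∀ {n : SimplexCategoryᵒᵖ} (a : A.obj n) (d : D.obj n) (h : g.app n d = fwd.app n a),
    f.app n (bwd a d h) = a
  map_bwd : ∀ {n m : SimplexCategoryᵒᵖ} (φ : n ⟶ m) (a : A.obj n) (d : D.obj n)
    (h : g.app n d = fwd.app n a) (h' : g.app m (D.map φ d) = fwd.app m (A.map φ a)),
    B.map φ (bwd a d h) = bwd (A.map φ a) (D.map φ d) h'

/-- The backward direction `D_{α⁺ a} ⟶ B_a` of a morphism of polynomials on a fibre. -/
def PolyHom.onFiber {A B C D : SSet.{u}} {f : B ⟶ A} {g : D ⟶ C} (e : PolyHom f g)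
    {n : SimplexCategoryᵒᵖ} (a : A.obj n) : fiber g (e.fwd.app n a) ⟶ fiber f a :=
  mkHom
    (fun m d => ⟨(d.1.1, e.bwd (A.map d.1.1 a) d.1.2
      (d.2.trans (NatTrans.naturality_apply e.fwd _ _).symm)), e.f_bwd _ _ _⟩)
    (fun {m k} φ d => by
      obtain ⟨⟨α, d⟩, h⟩ := d
      refine Subtype.ext (Prod.ext rfl ?_)
      have hd : g.app m d = e.fwd.app m (A.map α a) :=
        h.trans (NatTrans.naturality_apply e.fwd _ _).symm
      have hd' : g.app k (D.map φ d) = e.fwd.app k (A.map φ (A.map α a)) := by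
        rw [NatTrans.naturality_apply, hd]
        exact (NatTrans.naturality_apply e.fwd φ _).symm
      refine Eq.trans ?_ (e.map_bwd φ (A.map α a) d hd hd').symm
      change e.bwd (A.map (α ≫ φ) a) (D.map φ d) _ = _
      congr 1
      exact Functor.map_comp_apply A _ _ _)

/-- The natural transformation induced by a morphism of polynomials,
`(a, x) ↦ (α⁺ a, x ∘ α⁻_a)`. -/
def PolyHom.transf {A B C D : SSet.{u}} {f : B ⟶ A} {g : D ⟶ C} (e : PolyHom f g) :
    polyFunctor f ⟶ polyFunctor g where
  app X := mkHom (fun n p => ⟨e.fwd.app n p.1, e.onFiber p.1 ≫ p.2⟩)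
    (fun {n m} φ p => poly_ext g (NatTrans.naturality_apply e.fwd φ p.1) fun k α b hp hq => by
      refine fiber_congr p.2 rfl ?_ _ _
      change e.bwd (A.map α (A.map φ p.1)) b _ = e.bwd (A.map (φ ≫ α) p.1) b _
      congr 1
      exact (Functor.map_comp_apply A _ _ _).symm)
  naturality _ _ _ := ssetHom_ext fun _ _ => rfl

/-- The structure of an internal category in simplicial sets with codomain map `cod`. The arrow
`comp a b` is the composite of `b : E ⟶ D` and `a : D ⟶ C`. -/
structure InternalCat {T₀ T₁ : SSet.{u}} (cod : T₁ ⟶ T₀) where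
  dom : T₁ ⟶ T₀
  idn : T₀ ⟶ T₁
  comp : ∀ {n : SimplexCategoryᵒᵖ} (a b : T₁.obj n), cod.app n b = dom.app n a → T₁.obj n
  map_comp : ∀ {n m : SimplexCategoryᵒᵖ} (φ : n ⟶ m) (a b : T₁.obj n)
    (h : cod.app n b = dom.app n a) (h' : cod.app m (T₁.map φ b) = dom.app m (T₁.map φ a)),
    T₁.map φ (comp a b h) = comp (T₁.map φ a) (T₁.map φ b) h'
  cod_idn : ∀ {n : SimplexCategoryᵒᵖ} (c : T₀.obj n), cod.app n (idn.app n c) = c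
  dom_idn : ∀ {n : SimplexCategoryᵒᵖ} (c : T₀.obj n), dom.app n (idn.app n c) = c
  cod_comp : ∀ {n : SimplexCategoryᵒᵖ} (a b : T₁.obj n) (h : cod.app n b = dom.app n a),
    cod.app n (comp a b h) = cod.app n a
  dom_comp : ∀ {n : SimplexCategoryᵒᵖ} (a b : T₁.obj n) (h : cod.app n b = dom.app n a),
    dom.app n (comp a b h) = dom.app n b
  idn_comp : ∀ {n : SimplexCategoryᵒᵖ} (c : T₀.obj n) (b : T₁.obj n)
    (h : cod.app n b = dom.app n (idn.app n c)), comp (idn.app n c) b h = b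
  comp_idn : ∀ {n : SimplexCategoryᵒᵖ} (a : T₁.obj n) (c : T₀.obj n)
    (h : cod.app n (idn.app n c) = dom.app n a), comp a (idn.app n c) h = a
  assoc : ∀ {n : SimplexCategoryᵒᵖ} (a b c : T₁.obj n) (hab : cod.app n b = dom.app n a)
    (hbc : cod.app n c = dom.app n b) (h : cod.app n c = dom.app n (comp a b hab))
    (h' : cod.app n (comp b c hbc) = dom.app n a),
    comp (comp a b hab) c h = comp a (comp b c hbc) h'

namespace InternalCat

variable {T₀ T₁ : SSet.{u}} {cod : T₁ ⟶ T₀}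

/-- The counit of the polynomial comonad of an internal category: evaluation at the identity. -/
def counit (c : InternalCat cod) : polyFunctor cod ⟶ 𝟭 SSet.{u} where
  app X := mkHom
    (fun n p => p.2.app n ⟨(𝟙 n, c.idn.app n p.1), by simp [c.cod_idn]⟩)
    (fun {n m} φ p => by
      refine Eq.trans ?_ (fiber_nat p.2 (𝟙 n) (c.idn.app n p.1) (by simp [c.cod_idn]) φ
        (by rw [← NatTrans.naturality_apply, c.cod_idn]; simp)).symm
      exact fiber_congr p.2 ((Category.comp_id φ).trans (Category.id_comp φ).symm) (NatTrans.naturality_apply c.idn φ p.1) _ _)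
  naturality _ _ _ := ssetHom_ext fun _ _ => rfl

/-- Composition `b ↦ a ∘ b` with an arrow `a : D ⟶ C`, as a map from the fibre of `cod` over `D`
to the fibre of `cod` over `C`. -/
def postcomp (c : InternalCat cod) {n m : SimplexCategoryᵒᵖ} {x : T₀.obj n}
    (a : (fiber cod x).obj m) : fiber cod (c.dom.app m a.1.2) ⟶ fiber cod x :=
  mkHom
    (fun k b => ⟨(a.1.1 ≫ b.1.1, c.comp (T₁.map b.1.1 a.1.2) b.1.2
      (b.2.trans (NatTrans.naturality_apply c.dom _ _).symm)), by
        rw [c.cod_comp, NatTrans.naturality_apply, a.2, Functor.map_comp_apply]⟩)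
    (fun {k l} φ b => by
      obtain ⟨⟨β, b⟩, h⟩ := b
      refine Subtype.ext (Prod.ext (Category.assoc _ _ _).symm ?_)
      have hb : cod.app k b = c.dom.app k (T₁.map β a.1.2) :=
        h.trans (NatTrans.naturality_apply c.dom _ _).symm
      have hb' : cod.app l (T₁.map φ b) = c.dom.app l (T₁.map φ (T₁.map β a.1.2)) := by
        rw [NatTrans.naturality_apply, hb]
        exact (NatTrans.naturality_apply c.dom φ _).symm
      refine Eq.trans ?_ (c.map_comp φ (T₁.map β a.1.2) b hb hb').symm
      change c.comp (T₁.map (β ≫ φ) a.1.2) (T₁.map φ b) _ = _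
      congr 1
      exact Functor.map_comp_apply T₁ _ _ _)

/-- The element `a : D ⟶ C ↦ (D, b : E ⟶ D ↦ x (a ∘ b))` of `(P_cod X)^(cod⁻¹ C)`. -/
def comultFiber (c : InternalCat cod) {X : SSet.{u}} {n : SimplexCategoryᵒᵖ} {y : T₀.obj n}
    (x : fiber cod y ⟶ X) : fiber cod y ⟶ (polyFunctor cod).obj X :=
  mkHom (fun m a => ⟨c.dom.app m a.1.2, c.postcomp a ≫ x⟩)
    (fun {m k} φ a => poly_ext cod (NatTrans.naturality_apply c.dom φ a.1.2)
      fun l α b hp hq => by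
        refine fiber_congr x (Category.assoc _ _ _) ?_ _ _
        change c.comp (T₁.map α (T₁.map φ a.1.2)) b _ = c.comp (T₁.map (φ ≫ α) a.1.2) b _
        congr 1
        exact (Functor.map_comp_apply T₁ _ _ _).symm)

/-- The comultiplication of the polynomial comonad of an internal category: an element `(C, x)`
is sent to `(C, fun a : D ⟶ C => (D, fun b : E ⟶ D => x (a ∘ b)))`. -/
def comult (c : InternalCat cod) : polyFunctor cod ⟶ polyFunctor cod ⋙ polyFunctor cod where
  app _ := mkHom (fun _ p => ⟨p.1, c.comultFiber p.2⟩)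
    (fun _ p => poly_ext cod rfl fun _ _ _ _ _ => poly_ext cod rfl
      fun _ _ _ _ _ => fiber_congr p.2 (Category.assoc _ _ _).symm rfl _ _)
  naturality _ _ _ := ssetHom_ext fun _ _ => rfl

end InternalCat

end Polynomial

/-! ## Traversals -/

section Traversals

/-- The two directions of an edge of a traversal: `plus` points right, `minus` points left. -/
inductive Dir
  | plus
  | minus

/-- The opposite direction. -/
def Dir.neg : Dir → Dir
  | .plus => .minus
  | .minus => .plus

/-- An `n`-dimensional traversal: a finite sequence of elements of `[n] × {+, -}`. All edges are
required to have their direction in `D`. -/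
@[ext]
structure Trav (D : Set Dir) (n : ℕ) : Type u where
  edges : List (Fin (n + 1) × Dir)
  dir_mem : ∀ e ∈ edges, e.2 ∈ D

/-- The edges that replace an edge labelled `i` when `φ : [m] ⟶ [n]` acts: they point in the same
direction and are labelled by `φ⁻¹ i`, in decreasing order if the edge points to the right and in
increasing order if it points to the left. -/
def block {m n : ℕ} (φ : Fin (m + 1) →o Fin (n + 1)) :
    Fin (n + 1) × Dir → List (Fin (m + 1) × Dir)
  | (i, .plus) => ((List.finRange (m + 1)).filter (φ · = i)).reverse.map (·, .plus)
  | (i, .minus) => ((List.finRange (m + 1)).filter (φ · = i)).map (·, .minus)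

theorem block_dir {m n : ℕ} (φ : Fin (m + 1) →o Fin (n + 1)) (e : Fin (n + 1) × Dir)
    (e' : Fin (m + 1) × Dir) (h : e' ∈ block φ e) : e'.2 = e.2 := by
  obtain ⟨i, _ | _⟩ := e <;> simp [block] at h <;> grind

/-- The inverse image of an initial-to-final enumeration is enumerated blockwise. -/
theorem filter_flatMap {m n k : ℕ} (φ : Fin (m + 1) →o Fin (n + 1))
    (ψ : Fin (k + 1) →o Fin (m + 1)) (i : Fin (n + 1)) :
    ((List.finRange (m + 1)).filter (φ · = i)).flatMap
        (fun j => (List.finRange (k + 1)).filter (ψ · = j)) =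
      (List.finRange (k + 1)).filter (fun j => φ (ψ j) = i) := by
  refine List.Perm.eq_of_pairwise (le := (· < ·)) (fun a b _ _ h h' => absurd h h'.asymm) ?_ ?_ ?_
  · rw [List.pairwise_flatMap]
    refine ⟨fun j _ => (List.pairwise_lt_finRange _).filter _, ?_⟩
    refine ((List.pairwise_lt_finRange _).filter _).imp ?_
    intro a b hab x hx y hy
    simp at hx hy
    by_contra hxy
    have := ψ.monotone (not_lt.mp hxy)
    rw [hx, hy] at this
    exact absurd hab (not_lt.mpr this)
  · exact (List.pairwise_lt_finRange _).filter _
  · refine (List.perm_ext_iff_of_nodup ?_ ((List.nodup_finRange _).filter _)).mpr ?_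
    · rw [List.nodup_flatMap]
      refine ⟨fun j _ => (List.nodup_finRange _).filter _, ?_⟩
      refine ((List.nodup_finRange _).filter _).imp ?_
      intro a b hab x hx hy
      simp at hx hy
      exact hab (hx.symm.trans hy)
    · intro x
      simp

theorem block_comp {m n k : ℕ} (φ : Fin (m + 1) →o Fin (n + 1))
    (ψ : Fin (k + 1) →o Fin (m + 1)) (e : Fin (n + 1) × Dir) :
    (block φ e).flatMap (block ψ) = block (φ.comp ψ) e := by
  obtain ⟨i, _ | _⟩ := e
  · simp only [block, List.flatMap_map, OrderHom.comp_coe, Function.comp_apply]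
    rw [← filter_flatMap φ ψ i, List.reverse_flatMap, ← List.map_flatMap]
    simp [Function.comp_def]
  · simp only [block, List.flatMap_map, OrderHom.comp_coe, Function.comp_apply]
    rw [← filter_flatMap φ ψ i, List.map_flatMap]

theorem block_id {n : ℕ} (e : Fin (n + 1) × Dir) : block OrderHom.id e = [e] := by
  have h : ∀ i : Fin (n + 1), (List.finRange (n + 1)).filter (· = i) = [i] := by
    intro i
    refine List.perm_singleton.mp ((List.perm_ext_iff_of_nodup
      ((List.nodup_finRange _).filter _) (List.nodup_singleton i)).mpr fun x => ?_)
    simp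
  obtain ⟨i, _ | _⟩ := e <;> simp [block, h]

namespace Trav

variable {D : Set Dir} {n m k : ℕ}

/-- The number of edges. -/
def length (θ : Trav.{u} D n) : ℕ := θ.edges.length

/-- The traversal without edges. -/
def empty (D : Set Dir) (n : ℕ) : Trav.{u} D n := ⟨[], by simp⟩

/-- The part before a position. -/
def take (θ : Trav.{u} D n) (p : ℕ) : Trav.{u} D n :=
  ⟨θ.edges.take p, fun e he => θ.dir_mem e (List.mem_of_mem_take he)⟩

/-- The part after a position. -/
def drop (θ : Trav.{u} D n) (p : ℕ) : Trav.{u} D n :=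
  ⟨θ.edges.drop p, fun e he => θ.dir_mem e (List.mem_of_mem_drop he)⟩

/-- Concatenation. -/
def append (θ θ' : Trav.{u} D n) : Trav.{u} D n :=
  ⟨θ.edges ++ θ'.edges, fun e he =>
    (List.mem_append.mp he).elim (θ.dir_mem e) (θ'.dir_mem e)⟩

/-- The action of an operator: every edge is replaced by its block. -/
def act (φ : Fin (m + 1) →o Fin (n + 1)) (θ : Trav.{u} D n) : Trav.{u} D m :=
  ⟨θ.edges.flatMap (block φ), fun e he => by
    obtain ⟨e', he', h⟩ := List.mem_flatMap.mp he
    rw [block_dir φ e' e h]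
    exact θ.dir_mem e' he'⟩

/-- The traversal with order and orientation reversed. -/
def reverse (θ : Trav.{u} Set.univ n) : Trav.{u} Set.univ n :=
  ⟨(θ.edges.map fun e => (e.1, e.2.neg)).reverse, fun _ _ => Set.mem_univ _⟩

/-- The action of an operator on a position: the position after the copies of all edges before
the given position. -/
def actPos (φ : Fin (m + 1) →o Fin (n + 1)) (θ : Trav.{u} D n) (p : ℕ) : ℕ :=
  ((θ.take p).act φ).length

theorem act_id (θ : Trav.{u} D n) : θ.act OrderHom.id = θ := by
  ext1
  simp only [act]
  rw [show (block OrderHom.id : Fin (n + 1) × Dir → _) = fun e => [e] from funext block_id]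
  simp

theorem act_comp (φ : Fin (m + 1) →o Fin (n + 1)) (ψ : Fin (k + 1) →o Fin (m + 1))
    (θ : Trav.{u} D n) : θ.act (φ.comp ψ) = (θ.act φ).act ψ := by
  ext1
  simp only [act, List.flatMap_assoc, block_comp]

theorem act_append (φ : Fin (m + 1) →o Fin (n + 1)) (θ θ' : Trav.{u} D n) :
    (θ.append θ').act φ = (θ.act φ).append (θ'.act φ) := by
  ext1
  simp [act, append]

theorem take_append_drop (θ : Trav.{u} D n) (p : ℕ) : (θ.take p).append (θ.drop p) = θ := by
  ext1
  simp [append, take, drop]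

theorem length_append (θ θ' : Trav.{u} D n) :
    (θ.append θ').length = θ.length + θ'.length := by
  simp [length, append]

theorem take_append_length (θ θ' : Trav.{u} D n) : (θ.append θ').take θ.length = θ := by
  ext1
  simp [append, take, length]

theorem drop_append_length (θ θ' : Trav.{u} D n) : (θ.append θ').drop θ.length = θ' := by
  ext1
  simp [append, drop, length]

theorem take_append_add (θ θ' : Trav.{u} D n) (p : ℕ) :
    (θ.append θ').take (θ.length + p) = θ.append (θ'.take p) := by
  ext1
  simp [append, take, length, List.take_append]

theorem take_append_of_le (θ θ' : Trav.{u} D n) (p : ℕ) (h : p ≤ θ.length) :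
    (θ.append θ').take p = θ.take p := by
  ext1
  simp only [append, take]
  exact List.take_append_of_le_length h

theorem take_length (θ : Trav.{u} D n) : θ.take θ.length = θ := by
  ext1
  simp [take, length]

theorem length_take (θ : Trav.{u} D n) (p : ℕ) (h : p ≤ θ.length) : (θ.take p).length = p := by
  simp only [take, length, List.length_take] at h ⊢
  omega

theorem length_drop (θ : Trav.{u} D n) (p : ℕ) : (θ.drop p).length = θ.length - p := by
  simp [drop, length]

theorem take_take (θ : Trav.{u} D n) (p q : ℕ) (h : q ≤ p) : (θ.take p).take q = θ.take q := by
  ext1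
  simp [take, List.take_take, h]

theorem take_act (φ : Fin (m + 1) →o Fin (n + 1)) (θ : Trav.{u} D n) (p : ℕ) :
    (θ.act φ).take (θ.actPos φ p) = (θ.take p).act φ := by
  conv_lhs => rw [← θ.take_append_drop p]
  rw [act_append]
  unfold actPos
  rw [take_append_drop, take_append_length]

theorem drop_act (φ : Fin (m + 1) →o Fin (n + 1)) (θ : Trav.{u} D n) (p : ℕ) :
    (θ.act φ).drop (θ.actPos φ p) = (θ.drop p).act φ := by
  conv_lhs => rw [← θ.take_append_drop p]
  rw [act_append]
  unfold actPos
  rw [take_append_drop, drop_append_length]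

theorem actPos_id (θ : Trav.{u} D n) (p : ℕ) (h : p ≤ θ.length) :
    θ.actPos OrderHom.id p = p := by
  rw [actPos, act_id, length_take θ p h]

theorem actPos_comp (φ : Fin (m + 1) →o Fin (n + 1)) (ψ : Fin (k + 1) →o Fin (m + 1))
    (θ : Trav.{u} D n) (p : ℕ) :
    θ.actPos (φ.comp ψ) p = (θ.act φ).actPos ψ (θ.actPos φ p) := by
  rw [actPos, act_comp, ← take_act]
  rfl

theorem actPos_zero (φ : Fin (m + 1) →o Fin (n + 1)) (θ : Trav.{u} D n) :
    θ.actPos φ 0 = 0 := by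
  simp [actPos, take, act, length]

theorem actPos_length (φ : Fin (m + 1) →o Fin (n + 1)) (θ : Trav.{u} D n) :
    θ.actPos φ θ.length = (θ.act φ).length := by
  rw [actPos, take_length]

theorem actPos_le (φ : Fin (m + 1) →o Fin (n + 1)) (θ : Trav.{u} D n) (p : ℕ) :
    θ.actPos φ p ≤ (θ.act φ).length := by
  conv_rhs => rw [← θ.take_append_drop p, act_append, length_append]
  exact Nat.le_add_right _ _

theorem actPos_take (φ : Fin (m + 1) →o Fin (n + 1)) (θ : Trav.{u} D n) (p q : ℕ)
    (h : q ≤ p) : (θ.take p).actPos φ q = θ.actPos φ q := by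
  rw [actPos, take_take θ p q h, actPos]

theorem take_add (θ : Trav.{u} D n) (p q : ℕ) :
    θ.take (p + q) = (θ.take p).append ((θ.drop p).take q) := by
  ext1
  simp [take, drop, append, List.take_add]

theorem actPos_add (φ : Fin (m + 1) →o Fin (n + 1)) (θ : Trav.{u} D n) (p q : ℕ) :
    θ.actPos φ (p + q) = θ.actPos φ p + (θ.drop p).actPos φ q := by
  rw [actPos, take_add, act_append, length_append]
  rfl

theorem block_neg (φ : Fin (m + 1) →o Fin (n + 1)) (e : Fin (n + 1) × Dir) :
    block φ (e.1, e.2.neg) = ((block φ e).map fun e => (e.1, e.2.neg)).reverse := by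
  obtain ⟨i, _ | _⟩ := e <;> simp [block, Dir.neg, Function.comp_def, List.map_reverse]

theorem reverse_act (φ : Fin (m + 1) →o Fin (n + 1)) (θ : Trav.{u} Set.univ n) :
    (θ.act φ).reverse = θ.reverse.act φ := by
  ext1
  simp only [act, reverse, List.map_flatMap, List.reverse_flatMap, List.flatMap_map,
    ← List.map_reverse, block_neg]
  simp [Function.comp_def]

theorem length_reverse (θ : Trav.{u} Set.univ n) : θ.reverse.length = θ.length := by
  simp [reverse, length]

theorem take_reverse (θ : Trav.{u} Set.univ n) (p : ℕ) :
    θ.reverse.take p = (θ.drop (θ.length - p)).reverse := by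
  ext1
  simp [reverse, take, drop, length, List.take_reverse]

theorem actPos_reverse (φ : Fin (m + 1) →o Fin (n + 1)) (θ : Trav.{u} Set.univ n) (p : ℕ) :
    θ.actPos φ (θ.length - p) = (θ.act φ).length - θ.reverse.actPos φ p := by
  have h := congrArg length (congrArg (act φ) (θ.take_append_drop (θ.length - p)))
  rw [act_append, length_append] at h
  have h' : θ.reverse.actPos φ p = ((θ.drop (θ.length - p)).act φ).length := by
    rw [actPos, take_reverse, ← reverse_act, length_reverse]
  rw [h', actPos]
  omega

end Trav

/-- A pointed traversal: a traversal `θ : {1, …, l} → [n] × {+, -}` together with a position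
`p ∈ {0, …, l}`. -/
@[ext]
structure PTrav (D : Set Dir) (n : ℕ) : Type u where
  trav : Trav.{u} D n
  pos : ℕ
  pos_le : pos ≤ trav.length

/-- The action of an operator on pointed traversals. -/
def PTrav.act {D : Set Dir} {n m : ℕ} (φ : Fin (m + 1) →o Fin (n + 1)) (p : PTrav.{u} D n) :
    PTrav.{u} D m :=
  ⟨p.trav.act φ, p.trav.actPos φ p.pos, p.trav.actPos_le φ p.pos⟩

/-- The simplicial set `𝕋₀` of traversals. -/
def T₀ (D : Set Dir) : SSet.{u} :=
  mkSSet (fun n => Trav.{u} D n.unop.len) (fun φ θ => θ.act φ.unop.toOrderHom)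
    (fun _ θ => θ.act_id) (fun φ ψ θ => θ.act_comp φ.unop.toOrderHom ψ.unop.toOrderHom)

/-- The simplicial set `𝕋₁` of pointed traversals. -/
def T₁ (D : Set Dir) : SSet.{u} :=
  mkSSet (fun n => PTrav.{u} D n.unop.len) (fun φ p => p.act φ.unop.toOrderHom)
    (fun _ p => PTrav.ext p.trav.act_id (p.trav.actPos_id p.pos p.pos_le))
    (fun φ ψ p => PTrav.ext (p.trav.act_comp φ.unop.toOrderHom ψ.unop.toOrderHom)
      (p.trav.actPos_comp φ.unop.toOrderHom ψ.unop.toOrderHom p.pos))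

/-- The map `cod : 𝕋₁ ⟶ 𝕋₀` that forgets the position. -/
def cod (D : Set Dir) : T₁.{u} D ⟶ T₀.{u} D :=
  mkHom (fun _ p => p.trav) (fun _ _ => rfl)

/-- The simplicial poset of traversals with the final segment ordering: a position in `θ` is an
arrow to `θ` from the part of `θ` after that position. -/
def finalCat (D : Set Dir) : InternalCat (cod.{u} D) where
  dom := mkHom (fun _ p => p.trav.drop p.pos) (fun φ p => p.trav.drop_act φ.unop.toOrderHom p.pos)
  idn := mkHom (fun _ θ => ⟨θ, 0, Nat.zero_le _⟩)
    (fun φ θ => PTrav.ext rfl (θ.actPos_zero φ.unop.toOrderHom).symm)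
  comp a b h := ⟨a.trav, a.pos + b.pos, by
    have h1 : b.trav = a.trav.drop a.pos := h
    have h2 := b.pos_le
    have h3 := a.pos_le
    rw [h1, Trav.length_drop] at h2
    omega⟩
  map_comp φ a b h _ := PTrav.ext rfl (by
    have h1 : b.trav = a.trav.drop a.pos := h
    change a.trav.actPos φ.unop.toOrderHom (a.pos + b.pos) =
      a.trav.actPos φ.unop.toOrderHom a.pos + b.trav.actPos φ.unop.toOrderHom b.pos
    rw [Trav.actPos_add, h1])
  cod_idn _ := rfl
  dom_idn _ := rfl
  cod_comp _ _ _ := rfl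
  dom_comp a b h := by
    have h1 : b.trav = a.trav.drop a.pos := h
    refine Trav.ext ?_
    change a.trav.edges.drop (a.pos + b.pos) = b.trav.edges.drop b.pos
    rw [h1, ← List.drop_drop]
    rfl
  idn_comp c b h := PTrav.ext (show c = b.trav from h.symm) (Nat.zero_add _)
  comp_idn _ _ _ := rfl
  assoc a b c _ _ _ _ := PTrav.ext rfl (Nat.add_assoc _ _ _)

/-- The simplicial poset of traversals with the initial segment ordering: a position in `θ` is an
arrow to `θ` from the part of `θ` before that position. -/
def initialCat (D : Set Dir) : InternalCat (cod.{u} D) where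
  dom := mkHom (fun _ p => p.trav.take p.pos) (fun φ p => p.trav.take_act φ.unop.toOrderHom p.pos)
  idn := mkHom (fun _ θ => ⟨θ, θ.length, le_rfl⟩)
    (fun φ θ => PTrav.ext rfl (θ.actPos_length φ.unop.toOrderHom).symm)
  comp a b h := ⟨a.trav, b.pos, by
    have h1 : b.trav = a.trav.take a.pos := h
    have h2 := b.pos_le
    have h3 := a.pos_le
    rw [h1, Trav.length_take _ _ h3] at h2
    omega⟩
  map_comp φ a b h _ := PTrav.ext rfl (by
    have h1 : b.trav = a.trav.take a.pos := h
    have h2 := b.pos_le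
    rw [h1, Trav.length_take _ _ a.pos_le] at h2
    change a.trav.actPos φ.unop.toOrderHom b.pos = b.trav.actPos φ.unop.toOrderHom b.pos
    rw [h1, Trav.actPos_take _ _ _ _ h2])
  cod_idn _ := rfl
  dom_idn θ := θ.take_length
  cod_comp _ _ _ := rfl
  dom_comp a b h := by
    have h1 : b.trav = a.trav.take a.pos := h
    have h2 := b.pos_le
    rw [h1, Trav.length_take _ _ a.pos_le] at h2
    change a.trav.take b.pos = b.trav.take b.pos
    rw [h1, Trav.take_take _ _ _ h2]
  idn_comp c b h := PTrav.ext
    (show c = b.trav from (Eq.trans (show b.trav = c.take c.length from h) c.take_length).symm) rfl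
  comp_idn a c h := PTrav.ext rfl (by
    have h1 : c = a.trav.take a.pos := h
    change c.length = a.pos
    rw [h1, Trav.length_take _ _ a.pos_le])
  assoc _ _ _ _ _ _ _ := rfl

end Traversals

/-! ## The simplicial Moore path functor -/

section MoorePaths

/-- The simplicial Moore path functor `P_cod`, for traversals with directions in `D`. -/
def moore (D : Set Dir) : SSet.{u} ⥤ SSet.{u} := polyFunctor (cod.{u} D)

variable {D : Set Dir}

/-- Source: evaluation at the initial position. -/
def src (D : Set Dir) : moore.{u} D ⟶ 𝟭 SSet.{u} := (finalCat.{u} D).counit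

/-- Target: evaluation at the final position. -/
def tgt (D : Set Dir) : moore.{u} D ⟶ 𝟭 SSet.{u} := (initialCat.{u} D).counit

/-- The path contraction: at a position of a path it is the rest of the path. -/
def contract (D : Set Dir) : moore.{u} D ⟶ moore.{u} D ⋙ moore.{u} D := (finalCat.{u} D).comult

/-- The dual path contraction: at a position of a path it is the path up to that position. -/
def cocontract (D : Set Dir) : moore.{u} D ⟶ moore.{u} D ⋙ moore.{u} D :=
  (initialCat.{u} D).comult

/-- The trivial path on a simplex, given by the empty traversal. -/
def trivialPath (D : Set Dir) : 𝟭 SSet.{u} ⟶ moore.{u} D where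
  app X := mkHom
    (fun n x => ⟨(Trav.empty D n.unop.len : Trav.{u} D n.unop.len),
      mkHom (fun _ b => X.map b.1.1 x) (fun _ _ => Functor.map_comp_apply X _ _ _)⟩)
    (fun _ _ => poly_ext (cod.{u} D) rfl fun _ _ _ _ _ => (Functor.map_comp_apply X _ _ _).symm)
  naturality _ _ g := ssetHom_ext fun _ x => poly_ext (cod.{u} D) rfl fun _ α _ _ _ =>
    (NatTrans.naturality_apply g α x).symm

/-- The traversal of a Moore path. -/
def trav {X : SSet.{u}} {n : SimplexCategoryᵒᵖ} (p : ((moore.{u} D).obj X).obj n) :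
    Trav.{u} D n.unop.len := p.1

/-- The restriction of a traversal along an operator. -/
def restr {n m : SimplexCategoryᵒᵖ} (α : n ⟶ m) (θ : Trav.{u} D n.unop.len) :
    Trav.{u} D m.unop.len := θ.act α.unop.toOrderHom

theorem restr_comp {n m k : SimplexCategoryᵒᵖ} (α : n ⟶ m) (β : m ⟶ k)
    (θ : Trav.{u} D n.unop.len) : restr (α ≫ β) θ = restr β (restr α θ) :=
  θ.act_comp α.unop.toOrderHom β.unop.toOrderHom

/-- The restriction of a position in a traversal along an operator. -/
def restrPos {n m : SimplexCategoryᵒᵖ} (α : n ⟶ m) (θ : Trav.{u} D n.unop.len) (i : ℕ) : ℕ :=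
  θ.actPos α.unop.toOrderHom i

theorem restrPos_le {n m : SimplexCategoryᵒᵖ} (α : n ⟶ m) (θ : Trav.{u} D n.unop.len) (i : ℕ) :
    restrPos α θ i ≤ (restr α θ).length :=
  θ.actPos_le _ i

/-- The value of a Moore path at the `i`-th position of the restriction of its traversal
along `α`. -/
def val {X : SSet.{u}} {n m : SimplexCategoryᵒᵖ} (p : ((moore.{u} D).obj X).obj n) (α : n ⟶ m)
    (i : ℕ) (h : i ≤ (restr α (trav p)).length) : X.obj m :=
  p.2.app m ⟨(α, (⟨restr α (trav p), i, h⟩ : PTrav.{u} D m.unop.len)), rfl⟩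

theorem val_congr {X : SSet.{u}} {n m : SimplexCategoryᵒᵖ} (p : ((moore.{u} D).obj X).obj n)
    {α α' : n ⟶ m} {i i' : ℕ} (hα : α = α') (hi : i = i')
    (h : i ≤ (restr α (trav p)).length) (h' : i' ≤ (restr α' (trav p)).length) :
    val p α i h = val p α' i' h' := by
  subst hα hi; rfl

theorem app_eq_val {X : SSet.{u}} {n m : SimplexCategoryᵒᵖ} (p : ((moore.{u} D).obj X).obj n)
    (α : n ⟶ m) (b : PTrav.{u} D m.unop.len) (hb : b.trav = restr α (trav p)) (i : ℕ)
    (hi : b.pos = i) (h : i ≤ (restr α (trav p)).length) :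
    p.2.app m ⟨(α, b), hb⟩ = val p α i h :=
  fiber_congr p.2 rfl (PTrav.ext hb hi) _ _

theorem map_val {X : SSet.{u}} {n m k : SimplexCategoryᵒᵖ} (p : ((moore.{u} D).obj X).obj n)
    (α : n ⟶ m) (i : ℕ) (h : i ≤ (restr α (trav p)).length) (β : m ⟶ k) (j : ℕ)
    (hj : restrPos β (restr α (trav p)) i = j) (h' : j ≤ (restr (α ≫ β) (trav p)).length) :
    X.map β (val p α i h) = val p (α ≫ β) j h' :=
  (fiber_nat p.2 α _ rfl β (restr_comp α β (trav p)).symm).trans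
    (app_eq_val p (α ≫ β) _ _ j hj h')

theorem map_src {X : SSet.{u}} {n m : SimplexCategoryᵒᵖ} (p : ((moore.{u} D).obj X).obj n)
    (α : n ⟶ m) : X.map α (((src D).app X).app n p) = val p α 0 (Nat.zero_le _) := by
  refine (map_val p (𝟙 n) 0 (Nat.zero_le _) α 0 (Trav.actPos_zero _ _) (Nat.zero_le _) |>.symm.trans
    ?_).symm.trans (val_congr p (Category.id_comp α) rfl (Nat.zero_le _) _)
  exact congrArg (X.map α) (app_eq_val p (𝟙 n) _ _ 0 rfl _).symm

theorem map_tgt {X : SSet.{u}} {n m : SimplexCategoryᵒᵖ} (p : ((moore.{u} D).obj X).obj n)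
    (α : n ⟶ m) (i : ℕ) (hi : i = (restr α (trav p)).length) :
    X.map α (((tgt D).app X).app n p) = val p α i hi.le := by
  subst hi
  refine (map_val p (𝟙 n) (trav p).length ?_ α (restrPos α (trav p) (trav p).length) ?_ ?_
    |>.symm.trans ?_).symm.trans (val_congr p (Category.id_comp α) ?_ ?_ _)
  · exact (congrArg Trav.length (Trav.act_id (trav p))).ge
  · exact congrArg (fun θ => restrPos α θ (trav p).length) (Trav.act_id (trav p))
  · rw [Category.id_comp]; exact restrPos_le _ _ _
  · exact congrArg (X.map α) (app_eq_val p (𝟙 n) ((initialCat D).idn.app n p.1)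
      (Trav.act_id (trav p)).symm (trav p).length rfl _).symm
  · exact Trav.actPos_length _ _
  · rw [Category.id_comp]; exact restrPos_le _ _ _

/-- The value of the concatenation of `p` and `q` at the `i`-th position: a position in the
concatenated traversal is a position in the traversal of `p` or in that of `q`. -/
def concatVal {X : SSet.{u}} {n m : SimplexCategoryᵒᵖ} (p q : ((moore.{u} D).obj X).obj n)
    (α : n ⟶ m) (i : ℕ)
    (h : i ≤ (restr α (trav p)).length + (restr α (trav q)).length) : X.obj m :=
  if h' : i ≤ (restr α (trav p)).length then val p α i h'
  else val q α (i - (restr α (trav p)).length) (by omega)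

theorem concatVal_of_le {X : SSet.{u}} {n m : SimplexCategoryᵒᵖ}
    (p q : ((moore.{u} D).obj X).obj n) (α : n ⟶ m) (i : ℕ)
    (h : i ≤ (restr α (trav p)).length + (restr α (trav q)).length)
    (h' : i ≤ (restr α (trav p)).length) : concatVal p q α i h = val p α i h' :=
  dif_pos h'

theorem concatVal_add {X : SSet.{u}} {n m : SimplexCategoryᵒᵖ}
    (p q : ((moore.{u} D).obj X).obj n)
    (hpq : ((tgt D).app X).app n p = ((src D).app X).app n q)
    (α : n ⟶ m) (i j : ℕ) (h : j ≤ (restr α (trav q)).length)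
    (hij : i = (restr α (trav p)).length + j)
    (h' : i ≤ (restr α (trav p)).length + (restr α (trav q)).length) :
    concatVal p q α i h' = val q α j h := by
  subst hij
  unfold concatVal
  split_ifs with hj
  · obtain rfl : j = 0 := by omega
    rw [← map_src q α, ← hpq, map_tgt p α _ rfl]
    rfl
  · exact val_congr q rfl (by omega) _ _

theorem concatVal_congr {X : SSet.{u}} {n m : SimplexCategoryᵒᵖ}
    (p q : ((moore.{u} D).obj X).obj n) {α α' : n ⟶ m} {i i' : ℕ} (hα : α = α') (hi : i = i')
    (h : i ≤ (restr α (trav p)).length + (restr α (trav q)).length)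
    (h' : i' ≤ (restr α' (trav p)).length + (restr α' (trav q)).length) :
    concatVal p q α i h = concatVal p q α' i' h' := by
  subst hα hi; rfl

theorem map_concatVal {X : SSet.{u}} {n m k : SimplexCategoryᵒᵖ}
    (p q : ((moore.{u} D).obj X).obj n)
    (hpq : ((tgt D).app X).app n p = ((src D).app X).app n q)
    (α : n ⟶ m) (i : ℕ) (h : i ≤ (restr α (trav p)).length + (restr α (trav q)).length)
    (β : m ⟶ k) (j : ℕ)
    (hj : restrPos β ((restr α (trav p)).append (restr α (trav q))) i = j)
    (h' : j ≤ (restr (α ≫ β) (trav p)).length + (restr (α ≫ β) (trav q)).length) :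
    X.map β (concatVal p q α i h) = concatVal p q (α ≫ β) j h' := by
  subst hj
  by_cases hi : i ≤ (restr α (trav p)).length
  · have hj : restrPos β ((restr α (trav p)).append (restr α (trav q))) i =
        restrPos β (restr α (trav p)) i := by
      simp only [restrPos, Trav.actPos]
      rw [Trav.take_append_of_le _ _ _ hi]
    have hj' : restrPos β (restr α (trav p)) i ≤ (restr (α ≫ β) (trav p)).length := by
      rw [restr_comp]; exact restrPos_le _ _ _
    rw [concatVal_of_le p q α i h hi, concatVal_of_le p q (α ≫ β) _ h' (hj.trans_le hj'),
      map_val p α i hi β _ hj.symm]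
  · obtain ⟨l, rfl⟩ := Nat.exists_eq_add_of_le (not_le.mp hi).le
    have hl : l ≤ (restr α (trav q)).length := by omega
    have hj : restrPos β ((restr α (trav p)).append (restr α (trav q)))
        ((restr α (trav p)).length + l) =
          (restr (α ≫ β) (trav p)).length + restrPos β (restr α (trav q)) l := by
      simp only [restrPos, Trav.actPos]
      rw [Trav.take_append_add, Trav.act_append, Trav.length_append, restr_comp]
      rfl
    have hj' : restrPos β (restr α (trav q)) l ≤ (restr (α ≫ β) (trav q)).length := by
      rw [restr_comp]; exact restrPos_le _ _ _
    rw [concatVal_add p q hpq α _ l hl rfl, concatVal_add p q hpq (α ≫ β) _ _ hj' hj,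
      map_val q α l hl β _ rfl]

theorem pos_le_of_append {n m : SimplexCategoryᵒᵖ} {θ θ' : Trav.{u} D n.unop.len} (α : n ⟶ m)
    (b : PTrav.{u} D m.unop.len) (hb : b.trav = restr α (θ.append θ')) :
    b.pos ≤ (restr α θ).length + (restr α θ').length := by
  have h := b.pos_le
  rwa [hb, restr, Trav.act_append, Trav.length_append] at h

/-- Concatenation of Moore paths. -/
def concat {X : SSet.{u}} {n : SimplexCategoryᵒᵖ} (p q : ((moore.{u} D).obj X).obj n)
    (hpq : ((tgt D).app X).app n p = ((src D).app X).app n q) :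
    ((moore.{u} D).obj X).obj n :=
  ⟨(trav p).append (trav q), mkHom
    (fun _ b => concatVal p q b.1.1 b.1.2.pos (pos_le_of_append b.1.1 b.1.2 b.2))
    (fun β b => (map_concatVal p q hpq b.1.1 b.1.2.pos (pos_le_of_append b.1.1 b.1.2 b.2) β _
      (congrArg (fun θ => restrPos β θ b.1.2.pos)
        (Eq.trans (Trav.act_append _ _ _).symm b.2.symm)) _).symm)⟩

theorem concat_congr {X : SSet.{u}} {n : SimplexCategoryᵒᵖ}
    {p p' q q' : ((moore.{u} D).obj X).obj n} (hp : p = p') (hq : q = q')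
    (h : ((tgt D).app X).app n p = ((src D).app X).app n q)
    (h' : ((tgt D).app X).app n p' = ((src D).app X).app n q') :
    concat p q h = concat p' q' h' := by
  subst hp hq; rfl

theorem val_map {X : SSet.{u}} {n m k : SimplexCategoryᵒᵖ} (p : ((moore.{u} D).obj X).obj n)
    (φ : n ⟶ m) (α : m ⟶ k) (i : ℕ)
    (h : i ≤ (restr α (trav (((moore.{u} D).obj X).map φ p))).length)
    (h' : i ≤ (restr (φ ≫ α) (trav p)).length) :
    val (((moore.{u} D).obj X).map φ p) α i h = val p (φ ≫ α) i h' :=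
  app_eq_val p (φ ≫ α) _ (restr_comp φ α (trav p)).symm i rfl h'

theorem concatVal_map {X : SSet.{u}} {n m k : SimplexCategoryᵒᵖ}
    (p q : ((moore.{u} D).obj X).obj n) (φ : n ⟶ m) (α : m ⟶ k) (i : ℕ)
    (h : i ≤ (restr α (trav (((moore.{u} D).obj X).map φ p))).length +
      (restr α (trav (((moore.{u} D).obj X).map φ q))).length)
    (h' : i ≤ (restr (φ ≫ α) (trav p)).length + (restr (φ ≫ α) (trav q)).length) :
    concatVal (((moore.{u} D).obj X).map φ p) (((moore.{u} D).obj X).map φ q) α i h =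
      concatVal p q (φ ≫ α) i h' := by
  have hp : (restr α (trav (((moore.{u} D).obj X).map φ p))).length =
    (restr (φ ≫ α) (trav p)).length := congrArg Trav.length (restr_comp φ α (trav p)).symm
  unfold concatVal
  by_cases hi : i ≤ (restr (φ ≫ α) (trav p)).length
  · rw [dif_pos hi, dif_pos (hi.trans_eq hp.symm)]
    exact val_map p φ α i _ _
  · rw [dif_neg hi, dif_neg (fun h => hi (h.trans_eq hp))]
    refine (val_map q φ α _ _ ?_).trans (val_congr q rfl (by rw [hp]) _ _)
    omega

theorem src_map {X : SSet.{u}} {n m : SimplexCategoryᵒᵖ} (p : ((moore.{u} D).obj X).obj n)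
    (φ : n ⟶ m) : ((src D).app X).app m (((moore.{u} D).obj X).map φ p) =
      X.map φ (((src D).app X).app n p) :=
  ConcreteCategory.congr_hom (((src D).app X).naturality φ) p

theorem tgt_map {X : SSet.{u}} {n m : SimplexCategoryᵒᵖ} (p : ((moore.{u} D).obj X).obj n)
    (φ : n ⟶ m) : ((tgt D).app X).app m (((moore.{u} D).obj X).map φ p) =
      X.map φ (((tgt D).app X).app n p) :=
  ConcreteCategory.congr_hom (((tgt D).app X).naturality φ) p

theorem composable_map {X : SSet.{u}} {n m : SimplexCategoryᵒᵖ}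
    (p q : ((moore.{u} D).obj X).obj n)
    (h : ((tgt D).app X).app n p = ((src D).app X).app n q) (φ : n ⟶ m) :
    ((tgt D).app X).app m (((moore.{u} D).obj X).map φ p) =
      ((src D).app X).app m (((moore.{u} D).obj X).map φ q) := by
  rw [tgt_map, src_map, h]

theorem map_concat {X : SSet.{u}} {n m : SimplexCategoryᵒᵖ}
    (p q : ((moore.{u} D).obj X).obj n)
    (h : ((tgt D).app X).app n p = ((src D).app X).app n q) (φ : n ⟶ m) :
    ((moore.{u} D).obj X).map φ (concat p q h) =
      concat (((moore.{u} D).obj X).map φ p) (((moore.{u} D).obj X).map φ q)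
        (composable_map p q h φ) :=
  poly_ext (cod.{u} D) (Trav.act_append _ _ _) fun _ α b hb hb' =>
    (concatVal_map p q φ α b.pos (pos_le_of_append α b hb')
      (pos_le_of_append (φ ≫ α) b (Eq.trans hb (restr_comp φ α _).symm))).symm

theorem composable_app {X Y : SSet.{u}} (g : X ⟶ Y) {n : SimplexCategoryᵒᵖ}
    (p q : ((moore.{u} D).obj X).obj n)
    (h : ((tgt D).app X).app n p = ((src D).app X).app n q) :
    ((tgt D).app Y).app n (((moore.{u} D).map g).app n p) =
      ((src D).app Y).app n (((moore.{u} D).map g).app n q) :=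
  congrArg (g.app n) h

theorem map_app_concat {X Y : SSet.{u}} (g : X ⟶ Y) {n : SimplexCategoryᵒᵖ}
    (p q : ((moore.{u} D).obj X).obj n)
    (h : ((tgt D).app X).app n p = ((src D).app X).app n q)
    (h' : ((tgt D).app Y).app n (((moore.{u} D).map g).app n p) =
      ((src D).app Y).app n (((moore.{u} D).map g).app n q)) :
    ((moore.{u} D).map g).app n (concat p q h) =
      concat (((moore.{u} D).map g).app n p) (((moore.{u} D).map g).app n q) h' :=
  poly_ext (cod.{u} D) rfl fun m α b hb _ => by
    change g.app m (concatVal p q α b.pos (pos_le_of_append α b hb)) =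
      concatVal (((moore.{u} D).map g).app n p) (((moore.{u} D).map g).app n q) α b.pos
        (pos_le_of_append α b hb)
    unfold concatVal
    exact apply_dite _ _ _ _

theorem composable {X : SSet.{u}} {n : SimplexCategoryᵒᵖ}
    (z : (pullback ((tgt.{u} D).app X) ((src.{u} D).app X)).obj n) :
    ((tgt D).app X).app n
        ((pullback.fst ((tgt.{u} D).app X) ((src.{u} D).app X)).app n z) =
      ((src D).app X).app n
        ((pullback.snd ((tgt.{u} D).app X) ((src.{u} D).app X)).app n z) :=
  ssetHom_congr (pullback.condition (f := (tgt.{u} D).app X) (g := (src.{u} D).app X)) n z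

/-- Concatenation, as a map on the object of pairs of composable paths. -/
noncomputable def concatHom (D : Set Dir) (X : SSet.{u}) :
    pullback ((tgt.{u} D).app X) ((src.{u} D).app X) ⟶ (moore.{u} D).obj X :=
  mkHom
    (fun n z => concat
      ((pullback.fst ((tgt.{u} D).app X) ((src.{u} D).app X)).app n z)
      ((pullback.snd ((tgt.{u} D).app X) ((src.{u} D).app X)).app n z)
      (composable z))
    (fun φ z => Eq.trans
      (concat_congr
        (NatTrans.naturality_apply (pullback.fst ((tgt.{u} D).app X) ((src.{u} D).app X)) φ z)
        (NatTrans.naturality_apply (pullback.snd ((tgt.{u} D).app X) ((src.{u} D).app X)) φ z)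
        _ _)
      (map_concat _ _ _ φ).symm)

theorem concatHom_natural {X Y : SSet.{u}} (g : X ⟶ Y) :
    pullback.map ((tgt D).app X) ((src D).app X) ((tgt D).app Y) ((src D).app Y)
      ((moore.{u} D).map g) ((moore.{u} D).map g) g ((tgt D).naturality g).symm
      ((src D).naturality g).symm ≫ concatHom D Y = concatHom D X ≫ (moore.{u} D).map g := by
  generalize hL : pullback.map ((tgt D).app X) ((src D).app X) ((tgt D).app Y) ((src D).app Y)
      ((moore.{u} D).map g) ((moore.{u} D).map g) g ((tgt D).naturality g).symm
      ((src D).naturality g).symm = L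
  have h₁ : L ≫ pullback.fst _ _ = pullback.fst _ _ ≫ (moore.{u} D).map g := by
    rw [← hL]; exact pullback.lift_fst _ _ _
  have h₂ : L ≫ pullback.snd _ _ = pullback.snd _ _ ≫ (moore.{u} D).map g := by
    rw [← hL]; exact pullback.lift_snd _ _ _
  refine ssetHom_ext fun n z => ?_
  have e₁ := ssetHom_congr h₁ n z
  have e₂ := ssetHom_congr h₂ n z
  exact (concat_congr e₁ e₂ (composable (L.app n z)) (composable_app g _ _ (composable z))).trans
    (map_app_concat g _ _ (composable z) _).symm

/-- The Moore structure on simplicial sets carried by the simplicial Moore path functor, for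
traversals with directions in `D`. -/
noncomputable def mooreData (D : Set Dir) : MooreData (moore.{u} D) where
  s := src D
  t := tgt D
  r := trivialPath D
  Γ := contract D
  μ := concatHom D
  μ_natural g := concatHom_natural g
  α := polyStrength (cod.{u} D)
  α_natural := polyStrength_natural (cod.{u} D)

/-- The morphism of polynomials that reverses traversals and sends a position `p` in the reverse
of a traversal of length `l` to the position `l - p`. -/
def reverseHom : PolyHom (cod.{u} Set.univ) (cod.{u} Set.univ) where
  fwd := mkHom (fun _ θ => Trav.reverse θ) (fun _ θ => Trav.reverse_act _ θ)
  bwd θ d _ := ⟨θ, Trav.length θ - d.pos, Nat.sub_le _ _⟩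
  f_bwd _ _ _ := rfl
  map_bwd φ θ d h _ := PTrav.ext rfl (by
    have h1 : d.trav = Trav.reverse θ := h
    refine (Trav.actPos_reverse φ.unop.toOrderHom θ d.pos).trans ?_
    rw [← h1]
    rfl)

/-- The twist map, which reverses Moore paths. -/
def twist : moore.{u} Set.univ ⟶ moore.{u} Set.univ := reverseHom.transf

/-- The source and target maps of the Moore path functors for `D` and `D'` correspond under some
natural isomorphism between the two functors. -/
def SameEndpoints (D D' : Set Dir) : Prop :=
  ∃ φ : moore.{u} D ≅ moore.{u} D', φ.hom ≫ src.{u} D' = src.{u} D ∧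
    φ.hom ≫ tgt.{u} D' = tgt.{u} D

end MoorePaths

end SimplicialMoore

/-! ## Lifting to pullbacks preserved by a functor -/

section Abstract

variable {E : Type u} [Category.{v} E] [HasPullbacks E] (M : E ⥤ E)
  [PreservesLimitsOfShape WalkingCospan M] {A B C Z : E} (f : A ⟶ C) (g : B ⟶ C)
  (a : Z ⟶ M.obj A) (b : Z ⟶ M.obj B) (h : a ≫ M.map f = b ≫ M.map g)

/-! In each dimension a polynomial functor is a sum of functors `Hom(fiber f a, -)`, so it preserves
pullbacks. An internal category over `cod` turns it into a comonad whose laws are exactly the unit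
and associativity laws of the category (`InternalCat.isComonad`). The final and initial segment
orderings yield the comonads `(M, s, Γ)` and `(M, t, Γ*)`. They are strong because the strength only
adds a coordinate that is constant along fibres.

The remaining equations are statements about finite sequences. A Moore path is its traversal
together with its values at the positions of all restrictions of that traversal (`path_ext`), so
each equation splits into an identity of lists and an arithmetic identity between positions. In
these coordinates `Γ` at a position drops edges and shifts later positions, `Γ*` truncates and
leaves positions alone, concatenation reads off one of its two parts, and the twist passes to
complementary positions. The distributive laws then say that the remainder of "p, then q" is the
remainder of p followed by q, or else a remainder of q, and dually for initial parts. The sandwich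
equation says that an initial part followed by its remainder is the whole path. Directions play no
role here, so one argument with arbitrary `D` serves `M`, `M₊` and `M₋`; the twist exchanges the
directions and is treated for `Set.univ` only.

For distinctness, consider the fibre over a single edge of direction `d`, with its tautological
path. All 1-simplices of this fibre point the same way, from one end to the other, or are
degenerate. A path whose edges all have the opposite direction can therefore never advance from
position 0 to position 1, so no transformation that respects endpoints has a possible value on the
tautological path (`not_sameEndpoints`). -/

theorem pullbackPair_fst : pullbackPair M f g a b h ≫ M.map (pullback.fst f g) = a := by
  rw [pullbackPair, Category.assoc, PreservesPullback.iso_inv_fst, pullback.lift_fst]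

theorem pullbackPair_snd : pullbackPair M f g a b h ≫ M.map (pullback.snd f g) = b := by
  rw [pullbackPair, Category.assoc, PreservesPullback.iso_inv_snd, pullback.lift_snd]

end Abstract

namespace SimplicialMoore

/-! ## Polynomial functors -/

section Polynomial

variable {A B : SSet.{u}}

/-- For a fixed base, the covariant hom functor out of the fibre preserves pullbacks. A sum over
bases inherits this because all four maps leave the base unchanged. -/
theorem polyFunctor_map_isPullback (f : B ⟶ A) {W X Y Z : SSet.{u}} {a : W ⟶ X} {b : W ⟶ Y}
    {c : X ⟶ Z} {d : Y ⟶ Z} (h : IsPullback a b c d) :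
    IsPullback ((polyFunctor f).map a) ((polyFunctor f).map b) ((polyFunctor f).map c)
      ((polyFunctor f).map d) := by
  refine IsPullback.of_forall_isPullback_app fun n => ?_
  rw [Types.isPullback_iff]
  refine ⟨?_, ?_, ?_⟩
  · have := congrArg (fun k => k.app n) (h.toCommSq.map (polyFunctor f)).w
    exact this
  · rintro ⟨t, x⟩ ⟨t', x'⟩ ⟨h₁, h₂⟩
    -- Only the second component is changed by the functor, so equal images already force equal
    -- bases.
    obtain rfl : t = t' := congrArg Sigma.fst h₁
    have e₁ : x ≫ a = x' ≫ a := eq_of_heq (Sigma.mk.inj h₁).2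
    have e₂ : x ≫ b = x' ≫ b := eq_of_heq (Sigma.mk.inj h₂).2
    rw [h.hom_ext e₁ e₂]
  · rintro ⟨t, x⟩ ⟨t', x'⟩ hx
    obtain rfl : t = t' := congrArg Sigma.fst hx
    have e : x ≫ c = x' ≫ d := eq_of_heq (Sigma.mk.inj hx).2
    exact ⟨⟨t, h.lift x x' e⟩, congrArg (Sigma.mk t) (h.lift_fst x x' e),
      congrArg (Sigma.mk t) (h.lift_snd x x' e)⟩

instance polyFunctor_preservesPullbacks (f : B ⟶ A) :
    PreservesLimitsOfShape WalkingCospan (polyFunctor f) where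
  preservesLimit {K} := by
    have : PreservesLimit (cospan (K.map WalkingCospan.Hom.inl) (K.map WalkingCospan.Hom.inr))
        (polyFunctor f) :=
      preservesLimit_of_preserves_limit_cone (pullbackIsPullback _ _)
        ((isLimitMapConePullbackConeEquiv _ _).symm
          (polyFunctor_map_isPullback f (IsPullback.of_hasPullback _ _)).isLimit)
    exact preservesLimit_of_iso_diagram _ (diagramIsoCospan K).symm

theorem InternalCat.comp_congr {T₀ T₁ : SSet.{u}} {cod : T₁ ⟶ T₀} (c : InternalCat cod)
    {n : SimplexCategoryᵒᵖ} {a a' b b' : T₁.obj n} (ha : a = a') (hb : b = b')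
    (h : cod.app n b = c.dom.app n a) (h' : cod.app n b' = c.dom.app n a') :
    c.comp a b h = c.comp a' b' h' := by
  subst ha hb; rfl

/-- Evaluated on a fibre, the left counit law is `id ∘ b = b`, the right counit law is `a ∘ id = a`,
and coassociativity is `a ∘ (b ∘ d) = (a ∘ b) ∘ d`. -/
theorem InternalCat.isComonad {T₀ T₁ : SSet.{u}} {cod : T₁ ⟶ T₀} (c : InternalCat cod) :
    IsComonad (polyFunctor cod) c.counit c.comult where
  counit_left X := ssetHom_ext fun n p => poly_ext cod (c.dom_idn _) fun m α b hb hb' => by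
    have e : T₁.map α (c.idn.app n p.1) = c.idn.app m (T₀.map α p.1) :=
      (NatTrans.naturality_apply c.idn α p.1).symm
    refine fiber_congr p.2 (Category.id_comp α) ?_ _ _
    refine (c.comp_congr e rfl _ ?_).trans (c.idn_comp _ b ?_) <;>
      exact hb'.trans (c.dom_idn _).symm
  counit_right X := ssetHom_ext fun n p => poly_ext cod rfl fun m α b hb hb' => by
    refine fiber_congr p.2 (Category.comp_id α) ?_ _ _
    refine (c.comp_congr (Functor.map_id_apply T₁ _ b) rfl _ ?_).trans (c.comp_idn b _ ?_) <;>
      exact c.cod_idn _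
  coassoc X := ssetHom_ext fun n p => poly_ext cod rfl fun m α a ha ha' =>
    poly_ext cod rfl fun k β b hb hb' => poly_ext cod (c.dom_comp _ _ _).symm
      fun l γ d hd hd' => by
    refine fiber_congr p.2 (Category.assoc α β γ).symm ?_ _ _
    have hba : cod.app k b = c.dom.app k (T₁.map β a) :=
      hb.trans (NatTrans.naturality_apply c.dom β a).symm
    have hdb : cod.app l d = c.dom.app l (T₁.map γ b) :=
      hd.trans (NatTrans.naturality_apply c.dom γ b).symm
    have e : T₁.map (β ≫ γ) a = T₁.map γ (T₁.map β a) := Functor.map_comp_apply T₁ β γ a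
    have hba' : cod.app l (T₁.map γ b) = c.dom.app l (T₁.map γ (T₁.map β a)) := by
      rw [NatTrans.naturality_apply, NatTrans.naturality_apply, hba]
    have h₁ := hdb.trans (c.dom_comp _ _ hba').symm
    have h₂ := (c.cod_comp _ _ hdb).trans hba'
    -- Associativity applies to `a` and `b` restricted along `γ`; `map_comp` then identifies the
    -- composite of these restrictions with the restriction of the composite.
    exact (c.comp_congr e rfl _ h₂).trans ((c.assoc _ _ d hba' hdb h₁ h₂).symm.trans
      (c.comp_congr (c.map_comp γ _ b hba hba').symm rfl h₁ _))

/-- The two sides differ only in the first coordinate, where restricting once along `α ≫ β` is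
compared with restricting along `α` and then along `β`. -/
theorem InternalCat.comult_strong {T₀ T₁ : SSet.{u}} {cod : T₁ ⟶ T₀} (c : InternalCat cod)
    (X Y : SSet.{u}) :
    polyStrength cod X Y ≫ c.comult.app (X ⊗ Y) =
      (X ◁ c.comult.app Y) ≫ polyStrength cod X ((polyFunctor cod).obj Y) ≫
        (polyFunctor cod).map (polyStrength cod X Y) :=
  ssetHom_ext fun _ p => poly_ext cod rfl fun _ α _ _ _ => poly_ext cod rfl
    fun _ β _ _ _ => Prod.ext
      (show X.map (α ≫ β) p.1 = X.map β (X.map α p.1) from Functor.map_comp_apply X α β p.1) rfl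

theorem InternalCat.counit_strong {T₀ T₁ : SSet.{u}} {cod : T₁ ⟶ T₀} (c : InternalCat cod)
    (X Y : SSet.{u}) :
    polyStrength cod X Y ≫ c.counit.app (X ⊗ Y) = X ◁ c.counit.app Y :=
  ssetHom_ext fun n p => Prod.ext
    (show X.map (𝟙 n) p.1 = p.1 from Functor.map_id_apply X n p.1) rfl

theorem polyStrength_assoc (f : B ⟶ A) (X Y Z : SSet.{u}) :
    polyStrength f (X ⊗ Y) Z ≫ (polyFunctor f).map (α_ X Y Z).hom =
      (α_ X Y ((polyFunctor f).obj Z)).hom ≫ (X ◁ polyStrength f Y Z) ≫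
        polyStrength f X (Y ⊗ Z) :=
  ssetHom_ext fun _ _ => rfl

theorem polyStrength_snd (f : B ⟶ A) (X Y : SSet.{u}) :
    polyStrength f X Y ≫ (polyFunctor f).map (snd X Y) = snd X ((polyFunctor f).obj Y) :=
  ssetHom_ext fun _ _ => rfl

end Polynomial
/-! ## Calculus of Moore paths -/

section Paths

variable {D : Set Dir} {X Y : SSet.{u}} {n m k : SimplexCategoryᵒᵖ}

instance moore_preservesPullbacks (D : Set Dir) :
    PreservesLimitsOfShape WalkingCospan (moore.{u} D) :=
  polyFunctor_preservesPullbacks _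

/-! ### Restriction of traversals and positions -/

theorem restr_id (θ : Trav.{u} D n.unop.len) : restr (𝟙 n) θ = θ :=
  Trav.act_id θ

theorem restr_append (α : n ⟶ m) (θ θ' : Trav.{u} D n.unop.len) :
    restr α (θ.append θ') = (restr α θ).append (restr α θ') :=
  Trav.act_append _ θ θ'

theorem length_restr_append (α : n ⟶ m) (θ θ' : Trav.{u} D n.unop.len) :
    (restr α (θ.append θ')).length = (restr α θ).length + (restr α θ').length := by
  rw [restr_append, Trav.length_append]

theorem restrPos_append_of_le (α : n ⟶ m) (θ θ' : Trav.{u} D n.unop.len) {i : ℕ}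
    (h : i ≤ θ.length) : restrPos α (θ.append θ') i = restrPos α θ i := by
  simp only [restrPos, Trav.actPos]
  rw [Trav.take_append_of_le _ _ _ h]

theorem restrPos_append_add (α : n ⟶ m) (θ θ' : Trav.{u} D n.unop.len) (i : ℕ) :
    restrPos α (θ.append θ') (θ.length + i) = (restr α θ).length + restrPos α θ' i := by
  simp only [restrPos, Trav.actPos]
  rw [Trav.take_append_add, Trav.act_append, Trav.length_append]
  rfl

/-- Each edge of the restriction comes either from the first `i` edges or from the later ones. -/
theorem restrPos_add_length_restr_drop (α : n ⟶ m) (θ : Trav.{u} D n.unop.len) (i : ℕ) :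
    restrPos α θ i + (restr α (θ.drop i)).length = (restr α θ).length := by
  conv_rhs => rw [← θ.take_append_drop i, length_restr_append]
  rfl

/-- This replaces pointed traversals in a fibre by pairs of an operator and a natural number, which
removes the dependence of the fibre on the base. Later equations between paths are checked through
it. -/
theorem path_ext {p q : ((moore.{u} D).obj X).obj n} (h : trav p = trav q)
    (h' : ∀ (m : SimplexCategoryᵒᵖ) (α : n ⟶ m) (i : ℕ) (hp : i ≤ (restr α (trav p)).length)
      (hq : i ≤ (restr α (trav q)).length), val p α i hp = val q α i hq) : p = q := by
  refine poly_ext (cod.{u} D) h fun m α b hp hq => ?_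
  have hp' : b.pos ≤ (restr α (trav p)).length := b.pos_le.trans_eq (congrArg Trav.length hp)
  have hq' : b.pos ≤ (restr α (trav q)).length := b.pos_le.trans_eq (congrArg Trav.length hq)
  exact (app_eq_val p α b hp _ rfl hp').trans
    ((h' m α _ hp' hq').trans (app_eq_val q α b hq _ rfl hq').symm)

theorem val_eq_of_eq {p p' : ((moore.{u} D).obj X).obj n} (hp : p = p') (α : n ⟶ m) (i : ℕ)
    (h : i ≤ (restr α (trav p)).length) (h' : i ≤ (restr α (trav p')).length) :
    val p α i h = val p' α i h' := by
  subst hp; rfl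

theorem src_eq_val (p : ((moore.{u} D).obj X).obj n) :
    ((src D).app X).app n p = val p (𝟙 n) 0 (Nat.zero_le _) :=
  (Functor.map_id_apply X n _).symm.trans (map_src p (𝟙 n))

theorem tgt_eq_val (p : ((moore.{u} D).obj X).obj n) (i : ℕ)
    (hi : i = (restr (𝟙 n) (trav p)).length) :
    ((tgt D).app X).app n p = val p (𝟙 n) i hi.le :=
  (Functor.map_id_apply X n _).symm.trans (map_tgt p (𝟙 n) i hi)

/-- Composition in the final segment ordering adds positions, so position `j` of the remainder is
`j` steps beyond the restriction of `i`. The index `l` is a variable with an equation so that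
callers can supply it in any form. -/
theorem val_val_contract (p : ((moore.{u} D).obj X).obj n) (α : n ⟶ m) (i : ℕ)
    (h : i ≤ (restr α (trav p)).length) (β : m ⟶ k) (j : ℕ)
    (hj : j ≤ (restr β ((restr α (trav p)).drop i)).length) (l : ℕ)
    (hl : l = restrPos β (restr α (trav p)) i + j) (hl' : l ≤ (restr (α ≫ β) (trav p)).length) :
    val (val (((contract D).app X).app n p) α i h) β j hj = val p (α ≫ β) l hl' :=
  app_eq_val p (α ≫ β) _ (restr_comp α β (trav p)).symm l hl.symm hl'

/-- Composition in the initial segment ordering keeps the inner position, so there is no shift. -/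
theorem val_val_cocontract (p : ((moore.{u} D).obj X).obj n) (α : n ⟶ m) (i : ℕ)
    (h : i ≤ (restr α (trav p)).length) (β : m ⟶ k) (j : ℕ)
    (hj : j ≤ (restr β ((restr α (trav p)).take i)).length)
    (hj' : j ≤ (restr (α ≫ β) (trav p)).length) :
    val (val (((cocontract D).app X).app n p) α i h) β j hj = val p (α ≫ β) j hj' :=
  app_eq_val p (α ≫ β) _ (restr_comp α β (trav p)).symm j rfl hj'

theorem val_concat_of_le (p q : ((moore.{u} D).obj X).obj n)
    (hpq : ((tgt D).app X).app n p = ((src D).app X).app n q) (α : n ⟶ m) (i : ℕ)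
    (h : i ≤ (restr α (trav (concat p q hpq))).length) (h' : i ≤ (restr α (trav p)).length) :
    val (concat p q hpq) α i h = val p α i h' :=
  concatVal_of_le p q α i (h.trans_eq (length_restr_append α _ _)) h'

/-- The case `j = 0` is included: at the junction the values of `p` and `q` agree by `hpq`. -/
theorem val_concat_add (p q : ((moore.{u} D).obj X).obj n)
    (hpq : ((tgt D).app X).app n p = ((src D).app X).app n q) (α : n ⟶ m) (i j : ℕ)
    (h : i ≤ (restr α (trav (concat p q hpq))).length) (hj : j ≤ (restr α (trav q)).length)
    (hi : i = (restr α (trav p)).length + j) :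
    val (concat p q hpq) α i h = val q α j hj :=
  concatVal_add p q hpq α i j hj hi (h.trans_eq (length_restr_append α _ _))

/-- A path is a concatenation if it agrees with the two parts. -/
theorem eq_concat {w p q : ((moore.{u} D).obj X).obj n}
    (hpq : ((tgt D).app X).app n p = ((src D).app X).app n q)
    (ht : trav w = (trav p).append (trav q))
    (hp : ∀ (m : SimplexCategoryᵒᵖ) (α : n ⟶ m) (i : ℕ) (h : i ≤ (restr α (trav w)).length)
      (h' : i ≤ (restr α (trav p)).length), val w α i h = val p α i h')
    (hq : ∀ (m : SimplexCategoryᵒᵖ) (α : n ⟶ m) (i j : ℕ)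
      (h : i ≤ (restr α (trav w)).length) (hj : j ≤ (restr α (trav q)).length)
      (_ : i = (restr α (trav p)).length + j), val w α i h = val q α j hj) :
    w = concat p q hpq := by
  refine path_ext ht fun m α i hi hi' => ?_
  by_cases h : i ≤ (restr α (trav p)).length
  · exact (hp m α i hi h).trans (val_concat_of_le p q hpq α i hi' h).symm
  · obtain ⟨j, rfl⟩ := Nat.exists_eq_add_of_le (not_le.mp h).le
    have hj : j ≤ (restr α (trav q)).length :=
      Nat.le_of_add_le_add_left (hi'.trans_eq (length_restr_append α _ _))
    exact (hq m α _ j hi hj rfl).trans (val_concat_add p q hpq α _ j hi' hj rfl).symm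

/-! ### Category laws and cancellation for concatenation -/

theorem src_concat (p q : ((moore.{u} D).obj X).obj n)
    (hpq : ((tgt D).app X).app n p = ((src D).app X).app n q) :
    ((src D).app X).app n (concat p q hpq) = ((src D).app X).app n p := by
  rw [src_eq_val, src_eq_val]
  exact val_concat_of_le p q hpq _ 0 _ _

theorem tgt_concat (p q : ((moore.{u} D).obj X).obj n)
    (hpq : ((tgt D).app X).app n p = ((src D).app X).app n q) :
    ((tgt D).app X).app n (concat p q hpq) = ((tgt D).app X).app n q := by
  rw [tgt_eq_val _ _ rfl, tgt_eq_val q _ rfl]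
  exact val_concat_add p q hpq _ _ _ _ _ (length_restr_append _ _ _)

theorem concat_assoc (a b c : ((moore.{u} D).obj X).obj n)
    (hab : ((tgt D).app X).app n a = ((src D).app X).app n b)
    (hbc : ((tgt D).app X).app n b = ((src D).app X).app n c) :
    concat (concat a b hab) c ((tgt_concat a b hab).trans hbc) =
      concat a (concat b c hbc) (hab.trans (src_concat b c hbc).symm) := by
  have hl := fun (m : SimplexCategoryᵒᵖ) (α : n ⟶ m) =>
    length_restr_append α (trav a) (trav b)
  refine eq_concat _ (Trav.ext (List.append_assoc _ _ _)) ?_ ?_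
  · intro m α i h h'
    have h'' := h'.trans ((Nat.le_add_right _ _).trans_eq (hl m α).symm)
    exact (val_concat_of_le _ c _ α i h h'').trans (val_concat_of_le a b hab α i h'' h')
  · intro m α i j h hj hi
    -- A position past `a` lies in `b` or in `c`; on the left-hand side these cases belong to
    -- different outer parts.
    by_cases hjb : j ≤ (restr α (trav b)).length
    · have h'' : i ≤ (restr α ((trav a).append (trav b))).length := by rw [hl]; omega
      exact (val_concat_of_le _ c _ α i h h'').trans
        ((val_concat_add a b hab α i j h'' hjb hi).trans
          (val_concat_of_le b c hbc α j hj hjb).symm)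
    · obtain ⟨l, rfl⟩ := Nat.exists_eq_add_of_le (not_le.mp hjb).le
      have hl' : l ≤ (restr α (trav c)).length :=
        Nat.le_of_add_le_add_left (hj.trans_eq (length_restr_append α _ _))
      refine (val_concat_add _ c _ α i l h hl' ?_).trans
        (val_concat_add b c hbc α _ l hj hl' rfl).symm
      exact hi.trans (by rw [← Nat.add_assoc, ← hl]; rfl)

/-- Lists cancel, and the values of `b` are the values of the concatenation at positions shifted by
the length of `a`. -/
theorem concat_left_cancel {a b b' : ((moore.{u} D).obj X).obj n}
    (h : ((tgt D).app X).app n a = ((src D).app X).app n b)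
    (h' : ((tgt D).app X).app n a = ((src D).app X).app n b')
    (e : concat a b h = concat a b' h') : b = b' := by
  have ht : (trav a).append (trav b) = (trav a).append (trav b') := congrArg trav e
  refine path_ext (Trav.ext (List.append_cancel_left (congrArg Trav.edges ht)))
    fun m α i hi hi' => ?_
  have hl : (restr α (trav a)).length + i ≤ (restr α (trav (concat a b h))).length :=
    (Nat.add_le_add_left hi _).trans_eq (length_restr_append α _ _).symm
  have hl' := hl.trans_eq (congrArg (fun w => (restr α (trav w)).length) e)
  exact (val_concat_add a b h α _ i hl hi rfl).symm.trans
    ((val_eq_of_eq e α _ hl hl').trans (val_concat_add a b' h' α _ i hl' hi' rfl))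

theorem concat_right_cancel {a a' b : ((moore.{u} D).obj X).obj n}
    (h : ((tgt D).app X).app n a = ((src D).app X).app n b)
    (h' : ((tgt D).app X).app n a' = ((src D).app X).app n b)
    (e : concat a b h = concat a' b h') : a = a' := by
  have ht : (trav a).append (trav b) = (trav a').append (trav b) := congrArg trav e
  refine path_ext (Trav.ext (List.append_cancel_right (congrArg Trav.edges ht)))
    fun m α i hi hi' => ?_
  have hl : i ≤ (restr α (trav (concat a b h))).length :=
    hi.trans ((Nat.le_add_right _ _).trans_eq (length_restr_append α _ _).symm)
  have hl' := hl.trans_eq (congrArg (fun w => (restr α (trav w)).length) e)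
  exact (val_concat_of_le a b h α i hl hi).symm.trans
    ((val_eq_of_eq e α _ hl hl').trans (val_concat_of_le a' b h' α i hl' hi'))

/-- Reduces equations between maps built with `seq` to `concat` on simplices, so that the chosen
pullback disappears. -/
theorem seq_app {Z : SSet.{u}} (a b : Z ⟶ (moore.{u} D).obj X)
    (h : a ≫ (mooreData.{u} D).t.app X = b ≫ (mooreData.{u} D).s.app X) (z : Z.obj n) :
    ((mooreData.{u} D).seq a b h).app n z = concat (a.app n z) (b.app n z) (ssetHom_congr h n z) :=
  concat_congr (ssetHom_congr (pullback.lift_fst a b h) n z)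
    (ssetHom_congr (pullback.lift_snd a b h) n z) (composable ((pullback.lift a b h).app n z)) _

theorem trav_pointwiseSeq_app {Z : SSet.{u}} (a b : Z ⟶ (moore.{u} D).obj ((moore.{u} D).obj X))
    (h : a ≫ (moore.{u} D).map ((mooreData.{u} D).t.app X) =
      b ≫ (moore.{u} D).map ((mooreData.{u} D).s.app X)) (z : Z.obj n) :
    trav (((mooreData.{u} D).pointwiseSeq a b h).app n z) = trav (a.app n z) := by
  have e := congrArg trav
    (ssetHom_congr (pullbackPair_fst (moore.{u} D) _ _ a b h) n z)
  exact e

theorem composable_val {Z : SSet.{u}} {a b : Z ⟶ (moore.{u} D).obj ((moore.{u} D).obj X)}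
    (h : a ≫ (moore.{u} D).map ((mooreData.{u} D).t.app X) =
      b ≫ (moore.{u} D).map ((mooreData.{u} D).s.app X)) (z : Z.obj n) (α : n ⟶ m) (i : ℕ)
    (ha : i ≤ (restr α (trav (a.app n z))).length)
    (hb : i ≤ (restr α (trav (b.app n z))).length) :
    ((tgt D).app X).app m (val (a.app n z) α i ha) =
      ((src D).app X).app m (val (b.app n z) α i hb) :=
  val_eq_of_eq (ssetHom_congr h n z) α i ha hb

/-- The two projections of the path in the pullback are `a` and `b`; taking a value commutes with
projecting. -/
theorem val_pointwiseSeq_app {Z : SSet.{u}} (a b : Z ⟶ (moore.{u} D).obj ((moore.{u} D).obj X))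
    (h : a ≫ (moore.{u} D).map ((mooreData.{u} D).t.app X) =
      b ≫ (moore.{u} D).map ((mooreData.{u} D).s.app X)) (z : Z.obj n) (α : n ⟶ m) (i : ℕ)
    (hi : i ≤ (restr α (trav (((mooreData.{u} D).pointwiseSeq a b h).app n z))).length)
    (ha : i ≤ (restr α (trav (a.app n z))).length)
    (hb : i ≤ (restr α (trav (b.app n z))).length) :
    val (((mooreData.{u} D).pointwiseSeq a b h).app n z) α i hi =
      concat (val (a.app n z) α i ha) (val (b.app n z) α i hb)
        (composable_val h z α i ha hb) :=
  concat_congr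
    (val_eq_of_eq (ssetHom_congr (pullbackPair_fst (moore.{u} D) _ _ a b h) n z) α i hi ha)
    (val_eq_of_eq (ssetHom_congr (pullbackPair_snd (moore.{u} D) _ _ a b h) n z) α i hi hb)
    (composable (val ((pullbackPair (moore.{u} D) _ _ a b h).app n z) α i hi)) _

theorem trav_eq_of_composable {Z : SSet.{u}}
    {a b : Z ⟶ (moore.{u} D).obj ((moore.{u} D).obj X)}
    (h : a ≫ (moore.{u} D).map ((mooreData.{u} D).t.app X) =
      b ≫ (moore.{u} D).map ((mooreData.{u} D).s.app X)) (z : Z.obj n) :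
    trav (a.app n z) = trav (b.app n z) := by
  have e := congrArg trav (ssetHom_congr h n z)
  exact e

theorem src_pointwiseSeq_app {Z : SSet.{u}} (a b : Z ⟶ (moore.{u} D).obj ((moore.{u} D).obj X))
    (h : a ≫ (moore.{u} D).map ((mooreData.{u} D).t.app X) =
      b ≫ (moore.{u} D).map ((mooreData.{u} D).s.app X)) (z : Z.obj n)
    (hab : ((tgt D).app X).app n (((src D).app _).app n (a.app n z)) =
      ((src D).app X).app n (((src D).app _).app n (b.app n z))) :
    ((src D).app _).app n (((mooreData.{u} D).pointwiseSeq a b h).app n z) =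
      concat (((src D).app _).app n (a.app n z)) (((src D).app _).app n (b.app n z)) hab :=
  (src_eq_val _).trans ((val_pointwiseSeq_app a b h z _ 0 _ (Nat.zero_le _) (Nat.zero_le _)).trans
    (concat_congr (src_eq_val _).symm (src_eq_val _).symm _ _))

theorem tgt_pointwiseSeq_app {Z : SSet.{u}} (a b : Z ⟶ (moore.{u} D).obj ((moore.{u} D).obj X))
    (h : a ≫ (moore.{u} D).map ((mooreData.{u} D).t.app X) =
      b ≫ (moore.{u} D).map ((mooreData.{u} D).s.app X)) (z : Z.obj n)
    (hab : ((tgt D).app X).app n (((tgt D).app _).app n (a.app n z)) =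
      ((src D).app X).app n (((tgt D).app _).app n (b.app n z))) :
    ((tgt D).app _).app n (((mooreData.{u} D).pointwiseSeq a b h).app n z) =
      concat (((tgt D).app _).app n (a.app n z)) (((tgt D).app _).app n (b.app n z)) hab := by
  -- The final position is the length of the traversal, and the three paths of paths share one
  -- traversal.
  have e₁ := trav_pointwiseSeq_app a b h z
  have e₂ := trav_eq_of_composable h z
  refine (tgt_eq_val _ (restr (𝟙 n) (trav (a.app n z))).length (by rw [e₁])).trans
    ((val_pointwiseSeq_app a b h z _ _ _ le_rfl (by rw [e₂])).trans
      (concat_congr (tgt_eq_val _ _ rfl).symm (tgt_eq_val _ _ (by rw [e₂])).symm _ _))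

theorem trivialPath_concat (x : X.obj n) (p : ((moore.{u} D).obj X).obj n)
    (h : ((tgt D).app X).app n (((trivialPath D).app X).app n x) = ((src D).app X).app n p) :
    concat (((trivialPath D).app X).app n x) p h = p := by
  -- The target of the trivial path at `x` is `x` restricted along the identity, so composability
  -- determines `x`.
  have hx : x = ((src D).app X).app n p := (Functor.map_id_apply X n x).symm.trans h
  refine (eq_concat h rfl (fun m α i hi hi' => ?_) (fun m α i j hi hj hij => ?_)).symm
  · obtain rfl : i = 0 := Nat.le_zero.mp hi'
    exact (map_src p α).symm.trans (congrArg (X.map α) hx.symm)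
  · exact val_congr p rfl (hij.trans (Nat.zero_add j)) _ _

theorem concat_trivialPath (x : X.obj n) (p : ((moore.{u} D).obj X).obj n)
    (h : ((tgt D).app X).app n p = ((src D).app X).app n (((trivialPath D).app X).app n x)) :
    concat p (((trivialPath D).app X).app n x) h = p := by
  have hx : ((tgt D).app X).app n p = x := h.trans (Functor.map_id_apply X n x)
  refine (eq_concat h (Trav.ext (List.append_nil _).symm) (fun m α i hi hi' => rfl)
    (fun m α i j hi hj hij => ?_)).symm
  obtain rfl : j = 0 := Nat.le_zero.mp hj
  exact (map_tgt p α i hij).symm.trans (congrArg (X.map α) hx)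

end Paths

/-! ## The two-sided Moore structure -/

section TwoSided

variable {D : Set Dir}

theorem trivialPath_src (X : SSet.{u}) : (trivialPath D).app X ≫ (src D).app X = 𝟙 X :=
  ssetHom_ext fun n x => Functor.map_id_apply X n x

theorem trivialPath_tgt (X : SSet.{u}) : (trivialPath D).app X ≫ (tgt D).app X = 𝟙 X :=
  ssetHom_ext fun n x => Functor.map_id_apply X n x

theorem trivialPath_contract (X : SSet.{u}) :
    (trivialPath D).app X ≫ (contract D).app X =
      (trivialPath D).app X ≫ (trivialPath D).app ((moore.{u} D).obj X) :=
  ssetHom_ext fun _ _ => path_ext rfl fun _ _ _ _ _ => path_ext (Trav.ext List.drop_nil)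
    fun _ _ _ _ _ => rfl

theorem trivialPath_cocontract (X : SSet.{u}) :
    (trivialPath D).app X ≫ (cocontract D).app X =
      (trivialPath D).app X ≫ (trivialPath D).app ((moore.{u} D).obj X) :=
  ssetHom_ext fun _ _ => path_ext rfl fun _ _ _ _ _ => path_ext (Trav.ext List.take_nil)
    fun _ _ _ _ _ => rfl

/-- At the last position nothing remains, and the one value of this empty remainder is the endpoint.
-/
theorem contract_tgt (X : SSet.{u}) :
    (contract D).app X ≫ (tgt D).app ((moore.{u} D).obj X) =
      (tgt D).app X ≫ (trivialPath D).app X :=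
  ssetHom_ext fun n p => path_ext (Trav.ext (List.drop_length)) fun k β j hj hj' => by
    obtain rfl : j = 0 := Nat.le_zero.mp hj'
    refine (val_eq_of_eq (tgt_eq_val (((contract D).app X).app n p) _ rfl) β 0 _
      (Nat.zero_le _)).trans ((val_val_contract p (𝟙 n) _ le_rfl β 0 (Nat.zero_le _)
        (restr (𝟙 n ≫ β) (trav p)).length ?_ le_rfl).trans
          ((map_tgt p (𝟙 n ≫ β) _ rfl).symm.trans ?_))
    · rw [restr_comp]
      exact (Trav.actPos_length _ _).symm
    · rw [Category.id_comp]
      rfl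

/-- Every remainder ends where the whole path ends. -/
theorem tgt_val_contract {X : SSet.{u}} {n m : SimplexCategoryᵒᵖ}
    (p : ((moore.{u} D).obj X).obj n) (α : n ⟶ m) (i : ℕ)
    (hi : i ≤ (restr α (trav p)).length) :
    ((tgt D).app X).app m (val (((contract D).app X).app n p) α i hi) =
      X.map α (((tgt D).app X).app n p) := by
  refine (tgt_eq_val (val (((contract D).app X).app n p) α i hi) _ rfl).trans
    ((val_val_contract p α i hi (𝟙 m) _ le_rfl (restr (α ≫ 𝟙 m) (trav p)).length ?_ le_rfl).trans
      ((map_tgt p (α ≫ 𝟙 m) _ rfl).symm.trans ?_))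
  · rw [restr_comp]
    exact (restrPos_add_length_restr_drop _ _ _).symm
  · rw [Category.comp_id]

theorem src_val_contract {X : SSet.{u}} {n m : SimplexCategoryᵒᵖ}
    (p : ((moore.{u} D).obj X).obj n) (α : n ⟶ m) (i : ℕ)
    (hi : i ≤ (restr α (trav p)).length) :
    ((src D).app X).app m (val (((contract D).app X).app n p) α i hi) = val p α i hi := by
  -- Reading the remainder at position 0 gives `i` restricted along the identity, which `map_val`
  -- turns into the action of the identity on the value at `i`.
  have h : restrPos (𝟙 m) (restr α (trav p)) i ≤ (restr (α ≫ 𝟙 m) (trav p)).length := by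
    rw [restr_comp]
    exact restrPos_le _ _ _
  exact (src_eq_val (val (((contract D).app X).app n p) α i hi)).trans
    ((val_val_contract p α i hi (𝟙 m) 0 (Nat.zero_le _) _ rfl h).trans
      ((map_val p α i hi (𝟙 m) _ rfl h).symm.trans (Functor.map_id_apply X m _)))

theorem src_val_cocontract {X : SSet.{u}} {n m : SimplexCategoryᵒᵖ}
    (p : ((moore.{u} D).obj X).obj n) (α : n ⟶ m) (i : ℕ)
    (hi : i ≤ (restr α (trav p)).length) :
    ((src D).app X).app m (val (((cocontract D).app X).app n p) α i hi) =
      X.map α (((src D).app X).app n p) := by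
  refine (src_eq_val (val (((cocontract D).app X).app n p) α i hi)).trans
    ((val_val_cocontract p α i hi (𝟙 m) 0 (Nat.zero_le _) (Nat.zero_le _)).trans
      ((map_src p (α ≫ 𝟙 m)).symm.trans ?_))
  rw [Category.comp_id]

theorem tgt_val_cocontract {X : SSet.{u}} {n m : SimplexCategoryᵒᵖ}
    (p : ((moore.{u} D).obj X).obj n) (α : n ⟶ m) (i : ℕ)
    (hi : i ≤ (restr α (trav p)).length) :
    ((tgt D).app X).app m (val (((cocontract D).app X).app n p) α i hi) = val p α i hi := by
  have h : restrPos (𝟙 m) (restr α (trav p)) i ≤ (restr (α ≫ 𝟙 m) (trav p)).length := by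
    rw [restr_comp]
    exact restrPos_le _ _ _
  exact (tgt_eq_val (val (((cocontract D).app X).app n p) α i hi) _ rfl).trans
    ((val_val_cocontract p α i hi (𝟙 m) _ le_rfl h).trans
      ((map_val p α i hi (𝟙 m) _ rfl h).symm.trans (Functor.map_id_apply X m _)))

theorem cocontract_src (X : SSet.{u}) :
    (cocontract D).app X ≫ (src D).app ((moore.{u} D).obj X) =
      (src D).app X ≫ (trivialPath D).app X :=
  ssetHom_ext fun n p => path_ext rfl fun k β j hj hj' => by
    obtain rfl : j = 0 := Nat.le_zero.mp hj'
    refine (val_eq_of_eq (src_eq_val (((cocontract D).app X).app n p)) β 0 _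
      (Nat.zero_le _)).trans ((val_val_cocontract p (𝟙 n) 0 (Nat.zero_le _) β 0 (Nat.zero_le _)
        (Nat.zero_le _)).trans ((map_src p (𝟙 n ≫ β)).symm.trans ?_))
    rw [Category.id_comp]
    rfl

/-- Both sides take the value `t p`, suitably restricted, at every position. -/
theorem contract_map_tgt (X : SSet.{u}) :
    (contract D).app X ≫ (moore.{u} D).map ((tgt D).app X) =
      lift ((tgt D).app X) (pathLength (moore.{u} D) X) ≫ (mooreData D).constPath X :=
  ssetHom_ext fun _ p => path_ext rfl fun _ α i hi _ => tgt_val_contract p α i hi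

theorem cocontract_map_src (X : SSet.{u}) :
    (cocontract D).app X ≫ (moore.{u} D).map ((src D).app X) =
      lift ((src D).app X) (pathLength (moore.{u} D) X) ≫ (mooreData D).constPath X :=
  ssetHom_ext fun _ p => path_ext rfl fun _ α i hi _ => src_val_cocontract p α i hi

theorem seq_assoc {Z X : SSet.{u}} (a b c : Z ⟶ (moore.{u} D).obj X)
    (hab : a ≫ (mooreData.{u} D).t.app X = b ≫ (mooreData.{u} D).s.app X)
    (hbc : b ≫ (mooreData.{u} D).t.app X = c ≫ (mooreData.{u} D).s.app X) :
    ∃ h h', (mooreData.{u} D).seq ((mooreData.{u} D).seq a b hab) c h =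
      (mooreData.{u} D).seq a ((mooreData.{u} D).seq b c hbc) h' := by
  refine ⟨ssetHom_ext fun n z => ?_, ssetHom_ext fun n z => ?_, ssetHom_ext fun n z => ?_⟩
  · exact (congrArg (((tgt D).app X).app n) (seq_app a b hab z)).trans
      ((tgt_concat _ _ _).trans (ssetHom_congr hbc n z))
  · exact (ssetHom_congr hab n z).trans ((src_concat _ _ _).symm.trans
      (congrArg (((src D).app X).app n) (seq_app b c hbc z).symm))
  · refine (seq_app _ c _ z).trans (Eq.trans ?_ (seq_app a _ _ z).symm)
    exact (concat_congr (seq_app a b hab z) rfl _ _).trans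
      ((concat_assoc _ _ _ _ (ssetHom_congr hbc n z)).trans
        (concat_congr rfl (seq_app b c hbc z).symm _ _))

theorem concat_strong (X Y : SSet.{u}) :
    ∃ h, (X ◁ concatHom D Y) ≫ polyStrength (cod.{u} D) X Y =
      (mooreData.{u} D).seq
        ((X ◁ pullback.fst ((tgt D).app Y) ((src D).app Y)) ≫ polyStrength (cod.{u} D) X Y)
        ((X ◁ pullback.snd ((tgt D).app Y) ((src D).app Y)) ≫ polyStrength (cod.{u} D) X Y)
        h := by
  refine ⟨ssetHom_ext fun n w => Prod.ext rfl (composable w.2), ssetHom_ext fun n w => ?_⟩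
  refine (eq_concat _ rfl (fun m α i hi hi' => ?_) (fun m α i j hi hj hij => ?_)).trans (seq_app _ _ _ w).symm
  · refine Prod.ext (show X.map α w.1 = X.map α w.1 from rfl) ?_
    exact val_concat_of_le _ _ (composable w.2) α i hi hi'
  · refine Prod.ext (show X.map α w.1 = X.map α w.1 from rfl) ?_
    exact val_concat_add _ _ (composable w.2) α i j hi hj hij

/-! ### Distributive laws and sandwich equation, position by position -/

theorem restrPos_add_le {n m k : SimplexCategoryᵒᵖ} (α : n ⟶ m) (β : m ⟶ k)
    (θ : Trav.{u} D n.unop.len) (i j : ℕ)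
    (hj : j ≤ (restr β ((restr α θ).drop i)).length) :
    restrPos β (restr α θ) i + j ≤ (restr (α ≫ β) θ).length := by
  rw [restr_comp, ← restrPos_add_length_restr_drop β _ i]
  exact Nat.add_le_add_left hj _

/-- From a position in `p`, what remains is the rest of `p` and then all of `q`. This is the
pointwise part of the distributive law. -/
theorem contract_concat_val_of_le {X : SSet.{u}} {n m : SimplexCategoryᵒᵖ}
    (p q : ((moore.{u} D).obj X).obj n)
    (hpq : ((tgt D).app X).app n p = ((src D).app X).app n q) (α : n ⟶ m) (i : ℕ)
    (hi : i ≤ (restr α (trav (concat p q hpq))).length) (hi' : i ≤ (restr α (trav p)).length)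
    (h : ((tgt D).app X).app m (val (((contract D).app X).app n p) α i hi') =
      ((src D).app X).app m (((moore.{u} D).obj X).map α q)) :
    val (((contract D).app X).app n (concat p q hpq)) α i hi =
      concat (val (((contract D).app X).app n p) α i hi') (((moore.{u} D).obj X).map α q) h := by
  have ht : (restr α ((trav p).append (trav q))).drop i =
      ((restr α (trav p)).drop i).append (restr α (trav q)) := by
    rw [restr_append]
    exact Trav.ext (List.drop_append_of_le_length hi')
  have hr : ∀ {k : SimplexCategoryᵒᵖ} (β : m ⟶ k),
      restrPos β (restr α ((trav p).append (trav q))) i = restrPos β (restr α (trav p)) i :=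
    fun β => by rw [restr_append, restrPos_append_of_le _ _ _ hi']
  refine eq_concat _ ht (fun k β j hj hj' => ?_) (fun k β j l hj hl hjl => ?_)
  · have h₁ := restrPos_add_le α β (trav p) i j hj'
    have h₂ := h₁.trans ((Nat.le_add_right _ _).trans_eq
      (length_restr_append (α ≫ β) (trav p) (trav q)).symm)
    exact (val_val_contract _ α i hi β j hj _ (by rw [← hr]; rfl) h₂).trans
      ((val_concat_of_le p q hpq _ _ h₂ h₁).trans
        (val_val_contract p α i hi' β j hj' _ rfl h₁).symm)
  · have hl' : l ≤ (restr (α ≫ β) (trav q)).length := by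
      rw [restr_comp]
      exact hl
    have h₂ : (restr (α ≫ β) (trav p)).length + l ≤
        (restr (α ≫ β) ((trav p).append (trav q))).length := by
      rw [length_restr_append]
      exact Nat.add_le_add_left hl' _
    refine (val_val_contract _ α i hi β j hj _ ?_ h₂).trans
      ((val_concat_add p q hpq _ _ l h₂ hl' rfl).trans (val_map q α β l hl hl').symm)
    -- The edges of `p` before `i` and those after it, restricted along `β`, add up to the whole
    -- restriction of `p`; hence a position beyond the rest of `p` is a position of `q`.
    refine Eq.trans ?_ (congrArg (· + j) (hr β).symm)
    have := restrPos_add_length_restr_drop β (restr α (trav p)) i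
    rw [restr_comp, hjl, ← this, Nat.add_assoc]
    rfl

/-- From a position in `q`, the edges of `p` have all been passed. -/
theorem contract_concat_val_add {X : SSet.{u}} {n m : SimplexCategoryᵒᵖ}
    (p q : ((moore.{u} D).obj X).obj n)
    (hpq : ((tgt D).app X).app n p = ((src D).app X).app n q) (α : n ⟶ m) (i j : ℕ)
    (hi : i ≤ (restr α (trav (concat p q hpq))).length) (hj : j ≤ (restr α (trav q)).length)
    (hij : i = (restr α (trav p)).length + j) :
    val (((contract D).app X).app n (concat p q hpq)) α i hi =
      val (((contract D).app X).app n q) α j hj := by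
  have ht : (restr α ((trav p).append (trav q))).drop i = (restr α (trav q)).drop j := by
    rw [restr_append, hij]
    exact Trav.ext (List.drop_length_add_append _)
  refine path_ext ht fun k β l hl hl' => ?_
  have h₁ := restrPos_add_le α β (trav q) j l hl'
  have h₂ : (restr (α ≫ β) (trav p)).length + (restrPos β (restr α (trav q)) j + l) ≤
      (restr (α ≫ β) ((trav p).append (trav q))).length := by
    rw [length_restr_append]
    exact Nat.add_le_add_left h₁ _
  refine (val_val_contract _ α i hi β l hl _ ?_ h₂).trans
    ((val_concat_add p q hpq _ _ _ h₂ h₁ rfl).trans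
      (val_val_contract q α j hj β l hl' _ rfl h₁).symm)
  have hr : restrPos β (restr α ((trav p).append (trav q))) i =
      (restr (α ≫ β) (trav p)).length + restrPos β (restr α (trav q)) j := by
    rw [restr_append, hij, restrPos_append_add, restr_comp]
  rw [← Nat.add_assoc, ← hr]
  rfl

theorem cocontract_concat_val_of_le {X : SSet.{u}} {n m : SimplexCategoryᵒᵖ}
    (p q : ((moore.{u} D).obj X).obj n)
    (hpq : ((tgt D).app X).app n p = ((src D).app X).app n q) (α : n ⟶ m) (i : ℕ)
    (hi : i ≤ (restr α (trav (concat p q hpq))).length) (hi' : i ≤ (restr α (trav p)).length) :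
    val (((cocontract D).app X).app n (concat p q hpq)) α i hi =
      val (((cocontract D).app X).app n p) α i hi' := by
  have ht : (restr α ((trav p).append (trav q))).take i = (restr α (trav p)).take i := by
    rw [restr_append]
    exact Trav.take_append_of_le _ _ _ hi'
  refine path_ext ht fun k β l hl hl' => ?_
  have h₁ : l ≤ (restr (α ≫ β) (trav p)).length := by
    rw [restr_comp]
    exact hl'.trans (restrPos_le β _ i)
  have h₂ := h₁.trans ((Nat.le_add_right _ _).trans_eq
    (length_restr_append (α ≫ β) (trav p) (trav q)).symm)
  exact (val_val_cocontract _ α i hi β l hl h₂).trans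
    ((val_concat_of_le p q hpq _ _ h₂ h₁).trans (val_val_cocontract p α i hi' β l hl' h₁).symm)

/-- Up to a position in `q` one traverses all of `p` and then an initial part of `q`. -/
theorem cocontract_concat_val_add {X : SSet.{u}} {n m : SimplexCategoryᵒᵖ}
    (p q : ((moore.{u} D).obj X).obj n)
    (hpq : ((tgt D).app X).app n p = ((src D).app X).app n q) (α : n ⟶ m) (i j : ℕ)
    (hi : i ≤ (restr α (trav (concat p q hpq))).length) (hj : j ≤ (restr α (trav q)).length)
    (hij : i = (restr α (trav p)).length + j)
    (h : ((tgt D).app X).app m (((moore.{u} D).obj X).map α p) =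
      ((src D).app X).app m (val (((cocontract D).app X).app n q) α j hj)) :
    val (((cocontract D).app X).app n (concat p q hpq)) α i hi =
      concat (((moore.{u} D).obj X).map α p) (val (((cocontract D).app X).app n q) α j hj)
        h := by
  have ht : (restr α ((trav p).append (trav q))).take i =
      (restr α (trav p)).append ((restr α (trav q)).take j) := by
    rw [restr_append, hij]
    exact Trav.take_append_add _ _ _
  refine eq_concat _ ht (fun k β l hl hl' => ?_) (fun k β l o hl ho hlo => ?_)
  · have h₁ : l ≤ (restr (α ≫ β) (trav p)).length := by
      rw [restr_comp]
      exact hl'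
    have h₂ := h₁.trans ((Nat.le_add_right _ _).trans_eq
      (length_restr_append (α ≫ β) (trav p) (trav q)).symm)
    exact (val_val_cocontract _ α i hi β l hl h₂).trans
      ((val_concat_of_le p q hpq _ _ h₂ h₁).trans (val_map p α β l hl' h₁).symm)
  · have h₁ : o ≤ (restr (α ≫ β) (trav q)).length := by
      rw [restr_comp]
      exact ho.trans (restrPos_le β _ j)
    have hlo' : l = (restr (α ≫ β) (trav p)).length + o := by
      rw [restr_comp]
      exact hlo
    have h₂ : l ≤ (restr (α ≫ β) ((trav p).append (trav q))).length := by
      rw [length_restr_append, hlo']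
      exact Nat.add_le_add_left h₁ _
    exact (val_val_cocontract _ α i hi β l hl h₂).trans
      ((val_concat_add p q hpq _ _ _ h₂ h₁ hlo').trans
        (val_val_cocontract q α j hj β o ho h₁).symm)

/-- The sandwich equation at one position: cutting a path there and rejoining the pieces restores
it. -/
theorem concat_cocontract_contract {X : SSet.{u}} {n m : SimplexCategoryᵒᵖ}
    (p : ((moore.{u} D).obj X).obj n) (α : n ⟶ m) (i : ℕ)
    (hi : i ≤ (restr α (trav p)).length)
    (h : ((tgt D).app X).app m (val (((cocontract D).app X).app n p) α i hi) =
      ((src D).app X).app m (val (((contract D).app X).app n p) α i hi)) :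
    concat (val (((cocontract D).app X).app n p) α i hi)
      (val (((contract D).app X).app n p) α i hi) h = ((moore.{u} D).obj X).map α p := by
  refine (eq_concat h (Trav.take_append_drop _ i).symm (fun k β l hl hl' => ?_)
    (fun k β l o hl ho hlo => ?_)).symm
  · have h₁ : l ≤ (restr (α ≫ β) (trav p)).length := by
      rw [restr_comp]
      exact hl
    exact (val_map p α β l hl h₁).trans (val_val_cocontract p α i hi β l hl' h₁).symm
  · have h₁ : l ≤ (restr (α ≫ β) (trav p)).length := by
      rw [restr_comp]
      exact hl
    exact (val_map p α β l hl h₁).trans (val_val_contract p α i hi β o ho l hlo h₁).symm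

/-- Assembled from the two pointwise lemmas. Besides the values, both composability claims need
proof. -/
theorem concat_contract (X : SSet.{u}) :
    let p₁ : pullback ((tgt.{u} D).app X) ((src.{u} D).app X) ⟶ (moore.{u} D).obj X :=
      pullback.fst _ _
    let p₂ : pullback ((tgt.{u} D).app X) ((src.{u} D).app X) ⟶ (moore.{u} D).obj X :=
      pullback.snd _ _
    ∃ h h', concatHom D X ≫ (contract.{u} D).app X =
      (mooreData.{u} D).seq
        ((mooreData.{u} D).pointwiseSeq (p₁ ≫ (contract.{u} D).app X)
          (lift p₂ (p₁ ≫ pathLength (moore.{u} D) X) ≫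
            (mooreData.{u} D).constPath ((moore.{u} D).obj X)) h)
        (p₂ ≫ (contract.{u} D).app X) h' := by
  intro p₁ p₂
  have hc := fun (n : SimplexCategoryᵒᵖ)
    (z : (pullback ((tgt.{u} D).app X) ((src.{u} D).app X)).obj n) => composable z
  have h : (p₁ ≫ (contract.{u} D).app X) ≫ (moore.{u} D).map ((mooreData.{u} D).t.app X) =
      (lift p₂ (p₁ ≫ pathLength (moore.{u} D) X) ≫
        (mooreData.{u} D).constPath ((moore.{u} D).obj X)) ≫
          (moore.{u} D).map ((mooreData.{u} D).s.app X) :=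
    ssetHom_ext fun n z => path_ext rfl fun m α i hi _ =>
      (tgt_val_contract (p₁.app n z) α i hi).trans
        ((congrArg (X.map α) (hc n z)).trans (src_map (p₂.app n z) α).symm)
  refine ⟨h, ssetHom_ext fun n z => ?_, ssetHom_ext fun n z => ?_⟩
  · have e₁ := ssetHom_congr (contract_tgt (D := D) X) n (p₁.app n z)
    have e₂ : ((tgt D).app _).app n ((lift p₂ (p₁ ≫ pathLength (moore.{u} D) X) ≫
        (mooreData.{u} D).constPath ((moore.{u} D).obj X)).app n z) = p₂.app n z :=
      Functor.map_id_apply ((moore.{u} D).obj X) n (p₂.app n z)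
    -- At the junction, the pointwise concatenation is a trivial path followed by `p₂`, hence `p₂`,
    -- which is also where the contraction of `p₂` starts.
    have hr := (ssetHom_congr (trivialPath_tgt (D := D) X) n
      (((tgt D).app X).app n (p₁.app n z))).trans (hc n z)
    refine (tgt_pointwiseSeq_app _ _ h z ?_).trans ((concat_congr e₁ e₂ _ hr).trans
      ((trivialPath_concat _ _ hr).trans
        (ssetHom_congr ((finalCat D).isComonad.counit_left X) n (p₂.app n z)).symm))
    exact (congrArg (((tgt D).app X).app n) e₁).trans
      (hr.trans (congrArg (((src D).app X).app n) e₂).symm)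
  · refine (eq_concat _ ?_ (fun m α i hi hi' => ?_) (fun m α i j hi hj hij => ?_)).trans
      (seq_app _ _ _ z).symm
    · exact congrArg (fun θ => Trav.append θ (trav (p₂.app n z)))
        (trav_pointwiseSeq_app _ _ h z).symm
    · have hi₁ : i ≤ (restr α (trav (p₁.app n z))).length :=
        hi'.trans_eq (congrArg (fun θ => (restr α θ).length) (trav_pointwiseSeq_app _ _ h z))
      exact (contract_concat_val_of_le _ _ (hc n z) α i hi hi₁ _).trans
        (val_pointwiseSeq_app _ _ h z α i hi' hi₁ hi₁).symm
    · refine contract_concat_val_add _ _ (hc n z) α i j hi hj ?_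
      exact hij.trans (congrArg (fun θ => (restr α θ).length + j) (trav_pointwiseSeq_app _ _ h z))

theorem concat_cocontract (X : SSet.{u}) :
    let p₁ : pullback ((tgt.{u} D).app X) ((src.{u} D).app X) ⟶ (moore.{u} D).obj X :=
      pullback.fst _ _
    let p₂ : pullback ((tgt.{u} D).app X) ((src.{u} D).app X) ⟶ (moore.{u} D).obj X :=
      pullback.snd _ _
    ∃ h h', concatHom D X ≫ (cocontract.{u} D).app X =
      (mooreData.{u} D).seq (p₁ ≫ (cocontract.{u} D).app X)
        ((mooreData.{u} D).pointwiseSeq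
          (lift p₁ (p₂ ≫ pathLength (moore.{u} D) X) ≫
            (mooreData.{u} D).constPath ((moore.{u} D).obj X))
          (p₂ ≫ (cocontract.{u} D).app X) h) h' := by
  intro p₁ p₂
  have hc := fun (n : SimplexCategoryᵒᵖ)
    (z : (pullback ((tgt.{u} D).app X) ((src.{u} D).app X)).obj n) => composable z
  have h : (lift p₁ (p₂ ≫ pathLength (moore.{u} D) X) ≫
        (mooreData.{u} D).constPath ((moore.{u} D).obj X)) ≫
          (moore.{u} D).map ((mooreData.{u} D).t.app X) =
      (p₂ ≫ (cocontract.{u} D).app X) ≫ (moore.{u} D).map ((mooreData.{u} D).s.app X) :=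
    ssetHom_ext fun n z => path_ext rfl fun m α i hi _ =>
      (tgt_map (p₁.app n z) α).trans ((congrArg (X.map α) (hc n z)).trans
        (src_val_cocontract (p₂.app n z) α i hi).symm)
  refine ⟨h, ssetHom_ext fun n z => ?_, ssetHom_ext fun n z => ?_⟩
  · have e₁ : ((src D).app _).app n ((lift p₁ (p₂ ≫ pathLength (moore.{u} D) X) ≫
        (mooreData.{u} D).constPath ((moore.{u} D).obj X)).app n z) = p₁.app n z :=
      Functor.map_id_apply ((moore.{u} D).obj X) n (p₁.app n z)
    have e₂ := ssetHom_congr (cocontract_src (D := D) X) n (p₂.app n z)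
    -- Dually, the pointwise part starts at `p₁` followed by a trivial path, and the dual
    -- contraction of `p₁` ends at `p₁`.
    have hr := (hc n z).trans (ssetHom_congr (trivialPath_src (D := D) X) n
      (((src D).app X).app n (p₂.app n z))).symm
    refine Eq.symm ((src_pointwiseSeq_app _ _ h z ?_).trans ((concat_congr e₁ e₂ _ hr).trans
      ((concat_trivialPath _ _ hr).trans
        (ssetHom_congr ((initialCat D).isComonad.counit_left X) n (p₁.app n z)).symm)))
    exact (congrArg (((tgt D).app X).app n) e₁).trans
      (hr.trans (congrArg (((src D).app X).app n) e₂).symm)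
  · refine (eq_concat _ ?_ (fun m α i hi hi' => ?_) (fun m α i j hi hj hij => ?_)).trans
      (seq_app _ _ _ z).symm
    · exact congrArg (fun θ => Trav.append (trav (p₁.app n z)) θ)
        (trav_pointwiseSeq_app _ _ h z).symm
    · exact cocontract_concat_val_of_le _ _ (hc n z) α i hi hi'
    · have hj₁ : j ≤ (restr α (trav (p₂.app n z))).length :=
        hj.trans_eq (congrArg (fun θ => (restr α θ).length) (trav_pointwiseSeq_app _ _ h z))
      exact (cocontract_concat_val_add _ _ (hc n z) α i j hi hj₁ hij _).trans
        (val_pointwiseSeq_app _ _ h z α j hj hj₁ hj₁).symm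

theorem cocontract_contract (X : SSet.{u}) :
    ∃ h, (mooreData.{u} D).pointwiseSeq ((cocontract D).app X) ((contract D).app X) h =
      lift (𝟙 ((moore.{u} D).obj X)) (pathLength (moore.{u} D) X) ≫
        (mooreData.{u} D).constPath ((moore.{u} D).obj X) := by
  have h : (cocontract D).app X ≫ (moore.{u} D).map ((mooreData.{u} D).t.app X) =
      (contract D).app X ≫ (moore.{u} D).map ((mooreData.{u} D).s.app X) :=
    ssetHom_ext fun n p => path_ext rfl fun m α i hi _ =>
      (tgt_val_cocontract p α i hi).trans (src_val_contract p α i hi).symm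
  exact ⟨h, ssetHom_ext fun n p => path_ext (trav_pointwiseSeq_app _ _ h p)
    fun m α i hi hi' => (val_pointwiseSeq_app _ _ h p α i hi hi' hi').trans
      (concat_cocontract_contract p α i hi' _)⟩

theorem mooreData_isTwoSided (D : Set Dir) : (mooreData.{u} D).IsTwoSided (cocontract.{u} D) where
  preserves := moore_preservesPullbacks D
  r_s := trivialPath_src
  r_t := trivialPath_tgt
  μ_s _ := ssetHom_ext fun _ z => src_concat _ _ (composable z)
  μ_t _ := ssetHom_ext fun _ z => tgt_concat _ _ (composable z)
  unit_left X := ⟨ssetHom_ext fun n p => Functor.map_id_apply X n (((src D).app X).app n p),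
    ssetHom_ext fun _ p => (seq_app _ _ _ p).trans (trivialPath_concat _ p _)⟩
  unit_right X := ⟨ssetHom_ext fun n p =>
      (Functor.map_id_apply X n (((tgt D).app X).app n p)).symm,
    ssetHom_ext fun _ p => (seq_app _ _ _ p).trans (concat_trivialPath _ p _)⟩
  assoc := seq_assoc
  comonad := (finalCat D).isComonad
  α_assoc := polyStrength_assoc _
  α_snd := polyStrength_snd _
  α_s := (finalCat D).counit_strong
  α_t := (initialCat D).counit_strong
  α_r _ _ := ssetHom_ext fun _ _ => rfl
  α_μ := concat_strong
  α_Γ := (finalCat D).comult_strong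
  r_Γ := trivialPath_contract
  Γ_t := contract_tgt
  Γ_map_t := contract_map_tgt
  distrib := concat_contract
  comonad' := (initialCat D).isComonad
  α_Γ' := (initialCat D).comult_strong
  r_Γ' := trivialPath_cocontract
  Γ'_s := cocontract_src
  Γ'_map_s := cocontract_map_src
  distrib' := concat_cocontract
  left_cancel a b b' h h' e := ssetHom_ext fun n z =>
    concat_left_cancel (ssetHom_congr h n z) (ssetHom_congr h' n z)
      ((seq_app a b h z).symm.trans ((ssetHom_congr e n z).trans (seq_app a b' h' z)))
  right_cancel a a' b h h' e := ssetHom_ext fun n z =>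
    concat_right_cancel (ssetHom_congr h n z) (ssetHom_congr h' n z)
      ((seq_app a b h z).symm.trans ((ssetHom_congr e n z).trans (seq_app a' b h' z)))
  sandwich := cocontract_contract

end TwoSided

/-! ## The symmetric Moore structure -/

section Symmetric

variable {X : SSet.{u}} {n m : SimplexCategoryᵒᵖ}

theorem Trav.reverse_reverse {n : ℕ} (θ : Trav.{u} Set.univ n) : θ.reverse.reverse = θ := by
  ext1
  have h : ∀ e : Fin (n + 1) × Dir, (e.1, e.2.neg.neg) = e := by
    rintro ⟨i, _ | _⟩ <;> rfl
  simp [reverse, Function.comp_def, h]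

theorem Trav.reverse_append {n : ℕ} (θ θ' : Trav.{u} Set.univ n) :
    (θ.append θ').reverse = θ'.reverse.append θ.reverse := by
  ext1
  simp [reverse, append]

theorem length_restr_reverse (α : n ⟶ m) (θ : Trav.{u} Set.univ n.unop.len) :
    (restr α θ.reverse).length = (restr α θ).length := by
  rw [restr, ← Trav.reverse_act, Trav.length_reverse]
  rfl

/-- Complementary positions are recorded by `i + j = length` instead of a truncated subtraction,
which keeps later arithmetic additive. -/
theorem val_twist (p : ((moore.{u} Set.univ).obj X).obj n) (α : n ⟶ m) (i : ℕ)
    (h : i ≤ (restr α (Trav.reverse (trav p))).length) (j : ℕ)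
    (hij : i + j = (restr α (trav p)).length) :
    val ((twist.{u}.app X).app n p) α i h =
      val p α j ((Nat.le_add_left _ _).trans_eq hij) :=
  app_eq_val p α _ rfl j (show (restr α (trav p)).length - i = j by omega) _

theorem twist_twist (X : SSet.{u}) : twist.app X ≫ twist.app X = 𝟙 ((moore.{u} Set.univ).obj X) :=
  ssetHom_ext fun n p => path_ext (Trav.reverse_reverse _) fun m α i hi hi' => by
    obtain ⟨j, hj⟩ := Nat.exists_eq_add_of_le hi'
    have hj' : j ≤ (restr α (trav p).reverse).length := by
      rw [length_restr_reverse]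
      exact (Nat.le_add_left _ _).trans_eq hj.symm
    refine (val_twist ((twist.app X).app n p) α i hi j ?_).trans (val_twist p α j hj' i ?_)
    · exact hj.symm.trans (length_restr_reverse α _).symm
    · exact (Nat.add_comm _ _).trans hj.symm

theorem trivialPath_twist (X : SSet.{u}) :
    (trivialPath Set.univ).app X ≫ twist.app X = (trivialPath.{u} Set.univ).app X :=
  ssetHom_ext fun _ _ => path_ext rfl fun _ _ _ _ _ => rfl

theorem twist_src (X : SSet.{u}) : twist.app X ≫ (src Set.univ).app X = (tgt.{u} Set.univ).app X :=
  ssetHom_ext fun _ p => (src_eq_val _).trans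
    ((val_twist p _ 0 (Nat.zero_le _) _ (Nat.zero_add _)).trans (tgt_eq_val p _ rfl).symm)

theorem twist_tgt (X : SSet.{u}) : twist.app X ≫ (tgt Set.univ).app X = (src.{u} Set.univ).app X := by
  rw [← twist_src, ← Category.assoc, twist_twist, Category.id_comp]

/-- The first `i` edges are found by reversing the path, taking the remainder after the
complementary position, and reversing that remainder. The outer twist accounts for the complement
and the inner one for the second reversal. -/
theorem cocontract_eq (X : SSet.{u}) :
    (cocontract Set.univ).app X = twist.app X ≫ (contract Set.univ).app X ≫
      (moore Set.univ).map (twist.app X) ≫ twist.{u}.app ((moore Set.univ).obj X) :=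
  ssetHom_ext fun n p => path_ext (Trav.reverse_reverse _).symm fun m α i hi hi' => by
    have hθ : (restr α (trav p).reverse).reverse = restr α (trav p) := by
      rw [restr, Trav.reverse_act, Trav.reverse_reverse]
      rfl
    have hl : i ≤ (restr α (trav p).reverse).length := by
      rw [length_restr_reverse]
      exact hi
    obtain ⟨a, ha⟩ := Nat.exists_eq_add_of_le hl
    have ha' : a ≤ (restr α (trav p).reverse).length := (Nat.le_add_left _ _).trans_eq ha.symm
    refine Eq.trans (path_ext ?_ fun k β j hj hj' => ?_)
      (val_twist (((contract Set.univ).app X ≫ (moore Set.univ).map (twist.app X)).app n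
        ((twist.app X).app n p)) α i hi' a ha.symm).symm
    · have e := Trav.take_reverse (restr α (trav p).reverse) i
      rw [hθ, ha, Nat.add_sub_cancel_left] at e
      exact e
    · obtain ⟨b, hb⟩ := Nat.exists_eq_add_of_le (hj'.trans_eq (length_restr_reverse β _))
      have hb' := (Nat.le_add_left b j).trans_eq hb.symm
      have h₁ := restrPos_add_le α β (trav p).reverse a b hb'
      have h₂ : restrPos β (restr α (trav p).reverse) a + b + j =
          (restr (α ≫ β) (trav p)).length := by
        rw [← length_restr_reverse (α ≫ β), restr_comp, ← restrPos_add_length_restr_drop β _ a,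
          Nat.add_assoc, Nat.add_comm b]
        exact congrArg _ hb.symm
      exact (val_val_cocontract p α i hi β j hj ((Nat.le_add_left _ _).trans_eq h₂)).trans
        ((val_twist p (α ≫ β) _ h₁ j h₂).symm.trans
          ((val_val_contract ((twist.app X).app n p) α a ha' β b hb' _ rfl h₁).symm.trans
            (val_twist (val (((contract Set.univ).app X).app n ((twist.app X).app n p)) α a ha')
              β j hj' b hb.symm).symm))

theorem constPath_twist (X : SSet.{u}) :
    (mooreData.{u} Set.univ).constPath X ≫ twist.app X =
      (X ◁ twist.app (𝟙_ SSet.{u})) ≫ (mooreData.{u} Set.univ).constPath X :=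
  ssetHom_ext fun _ _ => path_ext rfl fun _ _ _ _ _ => rfl

theorem concat_twist (X : SSet.{u}) : ∃ h, concatHom Set.univ X ≫ twist.app X =
    (mooreData.{u} Set.univ).seq
      (pullback.snd ((tgt.{u} Set.univ).app X) ((src.{u} Set.univ).app X) ≫ twist.app X)
      (pullback.fst ((tgt.{u} Set.univ).app X) ((src.{u} Set.univ).app X) ≫ twist.app X) h := by
  refine ⟨?_, ssetHom_ext fun n z => ?_⟩
  · rw [Category.assoc, Category.assoc]
    exact (congrArg _ (twist_tgt X)).trans
      (pullback.condition.symm.trans (congrArg _ (twist_src X)).symm)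
  · refine (eq_concat _ ?_ (fun m α i hi hi' => ?_)
      (fun m α i j hi hj hij => ?_)).trans (seq_app _ _ _ z).symm
    · have e := Trav.reverse_append (trav ((pullback.fst ((tgt.{u} Set.univ).app X)
          ((src.{u} Set.univ).app X)).app n z)) (trav ((pullback.snd ((tgt.{u} Set.univ).app X)
          ((src.{u} Set.univ).app X)).app n z))
      exact e
    -- In the reversed second path the complement of `i` lies beyond the first path, by `l`
    -- positions.
    · obtain ⟨l, hl⟩ := Nat.exists_eq_add_of_le (hi'.trans_eq (length_restr_reverse α _))
      have hl' : l ≤ (restr α (trav ((pullback.snd ((tgt.{u} Set.univ).app X)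
          ((src.{u} Set.univ).app X)).app n z))).length := (Nat.le_add_left _ _).trans_eq hl.symm
      have h₁ := length_restr_append α (trav ((pullback.fst ((tgt.{u} Set.univ).app X)
          ((src.{u} Set.univ).app X)).app n z)) (trav ((pullback.snd ((tgt.{u} Set.univ).app X)
          ((src.{u} Set.univ).app X)).app n z))
      refine (val_twist _ α i hi _ ?_).trans ((val_concat_add _ _ (composable z) α _ l ?_ hl'
        rfl).trans (val_twist _ α i hi' l hl.symm).symm)
      · refine Eq.trans ?_ h₁.symm
        rw [Nat.add_left_comm]
        exact congrArg _ hl.symm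
      · exact (Nat.add_le_add_left hl' _).trans_eq h₁.symm
    -- Past the reversed second path the complement is a position `l` of the first path.
    · obtain ⟨l, hl⟩ := Nat.exists_eq_add_of_le (hj.trans_eq (length_restr_reverse α _))
      have hl' : l ≤ (restr α (trav ((pullback.fst ((tgt.{u} Set.univ).app X)
          ((src.{u} Set.univ).app X)).app n z))).length := (Nat.le_add_left _ _).trans_eq hl.symm
      have h₁ := length_restr_append α (trav ((pullback.fst ((tgt.{u} Set.univ).app X)
          ((src.{u} Set.univ).app X)).app n z)) (trav ((pullback.snd ((tgt.{u} Set.univ).app X)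
          ((src.{u} Set.univ).app X)).app n z))
      have h₂ := length_restr_reverse α (trav ((pullback.snd ((tgt.{u} Set.univ).app X)
          ((src.{u} Set.univ).app X)).app n z))
      refine (val_twist _ α i hi l ?_).trans ((val_concat_of_le _ _ (composable z) α l ?_
        hl').trans (val_twist _ α j hj l hl.symm).symm)
      · refine Eq.trans ?_ h₁.symm
        rw [hij, Nat.add_assoc, Nat.add_comm]
        exact congrArg₂ _ hl.symm h₂
      · exact (hl'.trans (Nat.le_add_right _ _)).trans_eq h₁.symm

theorem mooreData_isSymmetric :
    (mooreData.{u} Set.univ).IsSymmetric (cocontract.{u} Set.univ) twist.{u} where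
  toIsTwoSided := mooreData_isTwoSided Set.univ
  τ_τ := twist_twist
  r_τ := trivialPath_twist
  τ_s := twist_src
  τ_t := twist_tgt
  Γ'_eq := cocontract_eq
  α_τ := constPath_twist
  μ_τ := concat_twist

end Symmetric

/-! ## Distinctness -/

section Distinct

open Opposite SimplexCategory Simplicial

/-- The traversal of dimension `0` with a single edge. -/
def Trav.single {D : Set Dir} {d : Dir} (hd : d ∈ D) : Trav.{u} D 0 :=
  ⟨[(0, d)], by simpa using hd⟩

/-- The degeneracy operator of an edge. -/
def degen : op ⦋0⦌ ⟶ op ⦋1⦌ :=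
  Quiver.Hom.op (SimplexCategory.mkHom ⟨fun _ => 0, fun _ _ _ => le_rfl⟩)

/-- The operator that picks a vertex of an edge. -/
def vertex (k : Fin 2) : op ⦋1⦌ ⟶ op ⦋0⦌ :=
  Quiver.Hom.op (SimplexCategory.mkHom ⟨fun _ => k, fun _ _ _ => le_rfl⟩)

/-- The label of the first edge in the block of a degenerate edge with direction `d`. -/
def Dir.first (d : Dir) : Fin 2 :=
  match d with
  | .plus => 1
  | .minus => 0

theorem degen_vertex (k : Fin 2) : degen ≫ vertex k = 𝟙 (op ⦋0⦌) :=
  Quiver.Hom.unop_inj (SimplexCategory.isTerminalZero.hom_ext _ _)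

theorem eq_degen (α : op ⦋0⦌ ⟶ op ⦋1⦌) : α = degen :=
  Quiver.Hom.unop_inj (SimplexCategory.isTerminalZero.hom_ext _ _)

/-- Degenerating the edge gives two edges, of which the first is labelled `d.first`. Position 1
between them thus restricts to 1 at that vertex and to 0 at the other, which orients the
corresponding 1-simplex. -/
theorem restrPos_first {D : Set Dir} {d : Dir} (hd : d ∈ D) :
    restrPos (vertex d.first) (restr degen (Trav.single.{u} hd)) 1 = 1 := by
  cases d <;> rfl

theorem restrPos_first_neg {D : Set Dir} {d : Dir} (hd : d ∈ D) :
    restrPos (vertex d.neg.first) (restr degen (Trav.single.{u} hd)) 1 = 0 := by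
  cases d <;> rfl

theorem length_restr_single {D : Set Dir} {d : Dir} (hd : d ∈ D) :
    (restr degen (Trav.single.{u} hd)).length = 2 := by
  cases d <;> rfl

/-- Positions 0 and 2 restrict to the same end at both vertices; position 1 is the only
nondegenerate case. -/
theorem restrPos_neg_le {D : Set Dir} {d : Dir} (hd : d ∈ D) {i : ℕ} (hi : i ≤ 2) :
    restrPos (vertex d.neg.first) (restr degen (Trav.single.{u} hd)) i ≤
      restrPos (vertex d.first) (restr degen (Trav.single.{u} hd)) i := by
  obtain rfl | rfl | rfl : i = 0 ∨ i = 1 ∨ i = 2 := by omega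
  · exact (Trav.actPos_zero _ _).trans_le (Nat.zero_le _)
  · rw [restrPos_first, restrPos_first_neg]
    exact Nat.zero_le _
  · cases d <;> exact le_refl (1 : ℕ)

/-- In the fibre over a single edge, all edges point in the same direction. -/
theorem fiber_single_le {D : Set Dir} {d : Dir} (hd : d ∈ D)
    (x : (fiber (cod.{u} D) (n := op ⦋0⦌) (Trav.single.{u} hd)).obj (op ⦋1⦌)) :
    ((fiber (cod.{u} D) (n := op ⦋0⦌) (Trav.single.{u} hd)).map (vertex d.neg.first) x).1.2.pos ≤
      ((fiber (cod.{u} D) (n := op ⦋0⦌) (Trav.single.{u} hd)).map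
        (vertex d.first) x).1.2.pos := by
  obtain ⟨⟨α, θ, i, hi⟩, hx⟩ := x
  obtain rfl := eq_degen α
  obtain rfl : θ = restr degen (Trav.single.{u} hd) := hx
  exact restrPos_neg_le hd (hi.trans_eq (length_restr_single hd))

/-- In dimension 0 there is one label, so with one available direction every edge is the same. -/
theorem Trav.exists_eq_append_single {D : Set Dir} {d : Dir} (hD : ∀ e ∈ D, e = d)
    (θ : Trav.{u} D 0) {i : ℕ} (hi : i < θ.edges.length) :
    ∃ (hd : d ∈ D) (θ' : Trav.{u} D 0), θ = (θ.take i).append ((Trav.single hd).append θ') := by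
  have hm := θ.dir_mem _ (List.getElem_mem hi)
  have he : θ.edges[i] = (0, d) := Prod.ext (Subsingleton.elim (α := Fin 1) _ _) (hD _ hm)
  refine ⟨hD _ hm ▸ hm, θ.drop (i + 1), Trav.ext ?_⟩
  change θ.edges = θ.edges.take i ++ ([(0, d)] ++ θ.edges.drop (i + 1))
  rw [← he, List.singleton_append, List.getElem_cons_drop, List.take_append_drop]

/-- Consecutive vertices of a path are joined by an edge. -/
theorem exists_edge {D : Set Dir} {d : Dir} (hD : ∀ e ∈ D, e = d) {X : SSet.{u}}
    (p : ((moore.{u} D).obj X).obj (op ⦋0⦌)) {i : ℕ}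
    (h : i + 1 ≤ (restr (𝟙 (op ⦋0⦌)) (trav p)).length)
    (h' : i ≤ (restr (𝟙 (op ⦋0⦌)) (trav p)).length) :
    ∃ x : X.obj (op ⦋1⦌), X.map (vertex d.first) x = val p (𝟙 _) (i + 1) h ∧
      X.map (vertex d.neg.first) x = val p (𝟙 _) i h' := by
  rw [restr_id] at h h'
  obtain ⟨hd, θ, hθ⟩ := Trav.exists_eq_append_single hD (trav p) h
  have hl : (restr degen (trav p)).length = (restr degen ((trav p).take i)).length +
      ((restr degen (Trav.single.{u} hd)).length + (restr degen θ).length) := by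
    conv_lhs => rw [hθ]
    exact (length_restr_append (n := op ⦋0⦌) degen _ _).trans
      (congrArg _ (length_restr_append (n := op ⦋0⦌) degen _ _))
  -- The connecting 1-simplex is the value in the middle of the two copies of edge number `i + 1` in
  -- the degenerate traversal.
  have hx : (restr degen ((trav p).take i)).length + 1 ≤ (restr degen (trav p)).length := by
    rw [hl, length_restr_single]
    omega
  have hv (k : Fin 2) : restrPos (vertex k) (restr degen (trav p))
      ((restr degen ((trav p).take i)).length + 1) =
        i + restrPos (vertex k) (restr degen (Trav.single.{u} hd)) 1 := by
    conv_lhs => rw [hθ]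
    -- Degenerating and then taking a vertex is the identity, so the first `i` edges again
    -- contribute `i`.
    have e₁ : (restr (vertex k) (restr degen ((trav p).take i))).length = i := by
      rw [← restr_comp (n := op ⦋0⦌), degen_vertex]
      exact (congrArg Trav.length (restr_id (n := op ⦋0⦌) ((trav p).take i))).trans
        (Trav.length_take _ _ h')
    have e₂ : restr degen (((trav p).take i).append ((Trav.single.{u} hd).append θ)) =
        (restr degen ((trav p).take i)).append
          ((restr degen (Trav.single.{u} hd)).append (restr degen θ)) :=
      (restr_append (n := op ⦋0⦌) degen _ _).trans
        (congrArg _ (restr_append (n := op ⦋0⦌) degen _ _))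
    rw [e₂, ← hθ, restrPos_append_add, e₁, restrPos_append_of_le]
    rw [length_restr_single]
    exact one_le_two
  have hm (k : Fin 2) (j : ℕ)
      (hj : i + restrPos (vertex k) (restr degen (Trav.single.{u} hd)) 1 = j)
      (hj' : j ≤ (restr (𝟙 (op ⦋0⦌)) (trav p)).length) :
      X.map (vertex k) (val p degen _ hx) = val p (𝟙 _) j hj' := by
    have hj'' : j ≤ (restr (degen ≫ vertex k) (trav p)).length := by
      rwa [degen_vertex]
    exact (map_val p degen _ hx (vertex k) j ((hv k).trans hj) hj'').trans
      (val_congr p (degen_vertex k) rfl hj'' hj')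
  exact ⟨val p degen _ hx, hm _ _ (by rw [restrPos_first]) _,
    hm _ _ (by rw [restrPos_first_neg, Nat.add_zero]) _⟩

/-- A single edge with direction `d` cannot be replaced by a path in the opposite direction. -/
theorem not_sameEndpoints {D D' : Set Dir} {d : Dir} (hd : d ∈ D) (hD' : ∀ e ∈ D', e = d.neg) :
    ¬ SameEndpoints.{u} D D' := by
  rintro ⟨φ, hs, ht⟩
  have hdd : d.neg.neg = d := by cases d <;> rfl
  -- `p` is the tautological path in the fibre, whose value at a position is that position; `q` is
  -- its image in the other functor.
  let X := fiber (cod.{u} D) (n := op ⦋0⦌) (Trav.single.{u} hd)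
  let p : ((moore.{u} D).obj X).obj (op ⦋0⦌) := ⟨Trav.single.{u} hd, 𝟙 X⟩
  let q : ((moore.{u} D').obj X).obj (op ⦋0⦌) := (φ.hom.app X).app _ p
  have hmono : ∀ i (h : i ≤ (restr (𝟙 (op ⦋0⦌)) (trav q)).length),
      (val q (𝟙 _) i h).1.2.pos ≤ (val q (𝟙 _) 0 (Nat.zero_le _)).1.2.pos := by
    intro i
    induction i with
    | zero => exact fun _ => le_rfl
    | succ i ih =>
      intro h
      -- The edges of `q` point against `d`, so a step forward along `q` runs backward, or stays, in
      -- the fibre.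
      obtain ⟨x, h₁, h₂⟩ := exists_edge hD' q h (Nat.le_of_succ_le h)
      rw [hdd] at h₂
      refine le_trans ?_ (ih (Nat.le_of_succ_le h))
      rw [← h₁, ← h₂]
      exact fiber_single_le hd x
  have h₀ : ((src D').app X).app _ q = ((src D).app X).app _ p :=
    ssetHom_congr (congrArg (fun ψ => ψ.app X) hs) _ p
  have h₁ : ((tgt D').app X).app _ q = ((tgt D).app X).app _ p :=
    ssetHom_congr (congrArg (fun ψ => ψ.app X) ht) _ p
  have h := hmono _ le_rfl
  rw [← tgt_eq_val q _ rfl, ← src_eq_val q, h₀, h₁] at h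
  -- `q` shares the ends of `p`, namely position 0 at the start and position 1 at the end, so `h`
  -- reads `1 ≤ 0`.
  exact absurd h (Nat.not_succ_le_zero 0)

end Distinct

end SimplicialMoore

theorem mainTheorem6 :
    ((SimplicialMoore.mooreData.{u} Set.univ).IsSymmetric
        (SimplicialMoore.cocontract.{u} Set.univ) SimplicialMoore.twist.{u}) ∧
    ((SimplicialMoore.mooreData.{u} {SimplicialMoore.Dir.plus}).IsTwoSided
        (SimplicialMoore.cocontract.{u} {SimplicialMoore.Dir.plus})) ∧
    ((SimplicialMoore.mooreData.{u} {SimplicialMoore.Dir.minus}).IsTwoSided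
        (SimplicialMoore.cocontract.{u} {SimplicialMoore.Dir.minus})) ∧
    ¬ SimplicialMoore.SameEndpoints.{u} Set.univ {SimplicialMoore.Dir.plus} ∧
    ¬ SimplicialMoore.SameEndpoints.{u} Set.univ {SimplicialMoore.Dir.minus} ∧
    ¬ SimplicialMoore.SameEndpoints.{u} {SimplicialMoore.Dir.plus} {SimplicialMoore.Dir.minus} := by
  refine ⟨SimplicialMoore.mooreData_isSymmetric, SimplicialMoore.mooreData_isTwoSided _,
    SimplicialMoore.mooreData_isTwoSided _, ?_, ?_, ?_⟩
  -- The chosen edge has the direction that the second functor excludes.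
  · exact SimplicialMoore.not_sameEndpoints (Set.mem_univ SimplicialMoore.Dir.minus) fun _ => id
  · exact SimplicialMoore.not_sameEndpoints (Set.mem_univ SimplicialMoore.Dir.plus) fun _ => id
  · exact SimplicialMoore.not_sameEndpoints (Set.mem_singleton SimplicialMoore.Dir.plus) fun _ => id
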